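/- Let $k$ be a finite field of characteristic different from $2$, and let $f\in k[x]$ be a polynomial of odd degree such that the affine plane curve $y^2=f(x)$ is smooth. Let $L=k(x)$, let $K=L(y)$ with $y^2=f(x)$ be the function field of this curve, and let $X$ be the smooth complete curve with function field $K$. Its (closed) points are the discrete valuation rings of $K$ containing $k$, and the degree of a point is the degree over $k$ of its residue field. Let $\operatorname{Div}K$ be the free abelian group on the points of $X$, and let $\operatorname{Pic}K$ be its quotient by the principal divisors. For a point $\mathfrak p$ of $X$ let $\pi(\mathfrak p)$ be the point of $\mathbb P^1_k$ (that is, of $L$) below $\mathfrak p$ and let $f(\mathfrak p/\pi(\mathfrak p))$ be the inertia degree, i.e. the degree of the residue field of $\mathfrak p$ over that of $\pi(\mathfrak p)$. To a finite point of $\mathbb P^1_k$ assign the monic irreducible polynomial in $k[x]$ vanishing at it, and to the point at infinity assign the function $1/x$; extend this multiplicatively to a homomorphism $\operatorname{Div}L\to L^\times$. The norm $\mathbf n:\operatorname{Div}K\to L^\times$ is the composition of this homomorphism with $\operatorname{Div}K\to\operatorname{Div}L$, $\sum_i a_i\mathfrak p_i\mapsto\sum_i a_i\,f(\mathfrak p_i/\pi(\mathfrak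 p_i))\,\pi(\mathfrak p_i)$. Let $\mathfrak p\in X$ be a point of even degree. Then the class of $\mathfrak p$ lies in $2\operatorname{Pic}K$ if and only if there is $\lambda\in K$ with $$\mathbf n\,\mathfrak p = N_{K/L}(\lambda).$$ -/

import Mathlib

open Polynomial

noncomputable section

namespace FunctionFieldCurve

universe u v w

/-- A point of the smooth complete curve with function field `K` over the field `k`:
a discrete valuation ring of `K` that contains `k` (and has `K` as its field of fractions). -/
@[ext]
structure Point (k : Type u) (K : Type v) [Field k] [Field K] [Algebra k K] where
  /-- The valuation ring of the point. -/
  ring : ValuationSubring K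
  const_mem : ∀ c : k, algebraMap k K c ∈ ring
  isDVR : IsDiscreteValuationRing ring

namespace Point

variable {k : Type u} {K : Type v} [Field k] [Field K] [Algebra k K]

instance instIsDVR (P : Point k K) : IsDiscreteValuationRing P.ring := P.isDVR

instance instAlgebra (P : Point k K) : Algebra k P.ring :=
  ((algebraMap k K).codRestrict P.ring P.const_mem).toAlgebra

instance instIsScalarTower (P : Point k K) : IsScalarTower k P.ring K :=
  IsScalarTower.of_algebraMap_eq fun _ => rfl

/-- The residue field of a point. -/
abbrev residueField (P : Point k K) : Type v := IsLocalRing.ResidueField P.ring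

/-- The degree of a point: the degree of its residue field over `k`. -/
def degree (P : Point k K) : ℕ := Module.finrank k P.residueField

/-- The normalized discrete valuation of a point (with the junk value `P.ord 0 = 0`);
the sign is there because Mathlib's valuations are multiplicative. -/
def ord (P : Point k K) (a : K) : ℤ :=
  -WithZero.log ((IsDiscreteValuationRing.maximalIdeal P.ring).valuation K a)

lemma ord_mul (P : Point k K) {a b : K} (ha : a ≠ 0) (hb : b ≠ 0) :
    P.ord (a * b) = P.ord a + P.ord b := by
  unfold ord
  rw [map_mul, WithZero.log_mul ((Valuation.ne_zero_iff _).2 ha) ((Valuation.ne_zero_iff _).2 hb)]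
  ring

lemma ord_one (P : Point k K) : P.ord 1 = 0 := by simp [ord]

lemma ord_inv (P : Point k K) (a : K) : P.ord a⁻¹ = -P.ord a := by
  simp [ord, WithZero.log_inv]

end Point

/-! ### Divisors and the Picard group -/

section Divisors

variable (k : Type u) (K : Type v) [Field k] [Field K] [Algebra k K]

/-- The group of divisors of `K`: the free abelian group on the points. -/
abbrev Divisor : Type v := Point k K →₀ ℤ

/-- The group of principal divisors: `D` is principal when it is the divisor
`∑ (ord_P a) P` of some nonzero `a` in `K`. -/
def principalDivisors : AddSubgroup (Divisor k K) where
  carrier := {D | ∃ a : K, a ≠ 0 ∧ ∀ P : Point k K, D P = P.ord a}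
  zero_mem' := ⟨1, one_ne_zero, fun P => by simp [P.ord_one]⟩
  add_mem' := by
    rintro D E ⟨a, ha, hD⟩ ⟨b, hb, hE⟩
    exact ⟨a * b, mul_ne_zero ha hb, fun P => by
      rw [Finsupp.add_apply, hD, hE, P.ord_mul ha hb]⟩
  neg_mem' := by
    rintro D ⟨a, ha, hD⟩
    exact ⟨a⁻¹, inv_ne_zero ha, fun P => by rw [Finsupp.neg_apply, hD, P.ord_inv]⟩

/-- The Picard group of `K` (written additively): divisors modulo principal divisors. -/
abbrev Pic : Type v := Divisor k K ⧸ principalDivisors k K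

end Divisors

/-- The class of a point in the Picard group. -/
def Point.picClass {k : Type u} {K : Type v} [Field k] [Field K] [Algebra k K]
    (P : Point k K) : Pic k K :=
  QuotientAddGroup.mk (Finsupp.single P 1)

/-! ### The point below a point and the norm of a divisor -/

section Below

variable {k : Type u} {K : Type v} [Field k] [Field K] [Algebra k K]
variable (L : Type w) [Field L] [Algebra k L] [Algebra L K] [IsScalarTower k L K]

/-- The inclusion of the valuation ring `𝒪_P ∩ L` into `𝒪_P`. -/
def comapHom (V : ValuationSubring K) : V.comap (algebraMap L K) →+* V :=
  ((algebraMap L K).comp (V.comap (algebraMap L K)).subtype).codRestrict V fun a => a.2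

instance isLocalHom_comapHom (V : ValuationSubring K) : IsLocalHom (comapHom L V) where
  map_nonunit := by
    intro a ha
    obtain ⟨b, hb⟩ := isUnit_iff_exists_inv.1 ha
    have hb' : algebraMap L K a * (b : K) = 1 := congrArg Subtype.val hb
    have h0 : (a : L) ≠ 0 := by
      intro h
      simp [h] at hb'
    have hinv : (a : L)⁻¹ ∈ V.comap (algebraMap L K) := by
      rw [ValuationSubring.mem_comap, map_inv₀, inv_eq_of_mul_eq_one_right hb']
      exact b.2
    exact isUnit_iff_exists_inv.2 ⟨⟨_, hinv⟩, Subtype.ext (mul_inv_cancel₀ h0)⟩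

lemma isDVR_comap [Algebra.IsAlgebraic L K] (V : ValuationSubring K)
    [IsDiscreteValuationRing V] :
    IsDiscreteValuationRing (V.comap (algebraMap L K)) := by
  classical
  have hpir : IsPrincipalIdealRing (V.comap (algebraMap L K)) := by
    refine ⟨fun I => ?_⟩
    by_cases hI : I = ⊥
    · subst hI
      infer_instance
    · obtain ⟨x, hxI, hx0⟩ := Submodule.exists_mem_ne_zero_of_ne_bot hI
      let s : Set ℕ∞ := (fun a => IsDiscreteValuationRing.addVal V (comapHom L V a)) ''
        {a | a ∈ I ∧ a ≠ 0}
      have hs : s.Nonempty := ⟨_, x, ⟨hxI, hx0⟩, rfl⟩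
      obtain ⟨a, ⟨haI, ha0⟩, ha⟩ := WellFounded.min_mem wellFounded_lt s hs
      refine ⟨a, le_antisymm (fun b hb => ?_) ?_⟩
      · by_cases hb0 : b = 0
        · subst hb0
          exact Submodule.zero_mem _
        · have hle : IsDiscreteValuationRing.addVal V (comapHom L V a) ≤
              IsDiscreteValuationRing.addVal V (comapHom L V b) := by
            have := WellFounded.not_lt_min wellFounded_lt s
              (⟨b, ⟨hb, hb0⟩, rfl⟩ : IsDiscreteValuationRing.addVal V (comapHom L V b) ∈ s)
            exact ha.trans_le (not_lt.1 this)
          obtain ⟨c, hc⟩ := IsDiscreteValuationRing.addVal_le_iff_dvd.1 hle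
          have hc' : algebraMap L K b = algebraMap L K a * (c : K) := congrArg Subtype.val hc
          have ha0' : (a : L) ≠ 0 := fun h => ha0 (Subtype.ext h)
          have hdiv : (b : L) / a ∈ V.comap (algebraMap L K) := by
            rw [ValuationSubring.mem_comap, map_div₀, hc', mul_div_cancel_left₀ _
              ((map_ne_zero (algebraMap L K)).2 ha0')]
            exact c.2
          exact Submodule.mem_span_singleton.2
            ⟨⟨_, hdiv⟩, Subtype.ext (div_mul_cancel₀ _ ha0')⟩
      · exact (Submodule.span_singleton_le_iff_mem _ _).2 haI
  refine { hpir with not_a_field' := fun hbot => ?_ }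
  have hL : ∀ a : L, algebraMap L K a ∈ V := by
    intro a
    rcases (V.comap (algebraMap L K)).mem_or_inv_mem a with h | h
    · exact h
    · by_cases ha : a = 0
      · rw [ha, map_zero]
        exact V.zero_mem
      · have hu : IsUnit (⟨a⁻¹, h⟩ : V.comap (algebraMap L K)) := by
          by_contra hn
          have := (IsLocalRing.mem_maximalIdeal _).2 hn
          rw [hbot, Ideal.mem_bot] at this
          exact inv_ne_zero ha (congrArg Subtype.val this)
        obtain ⟨b, hb⟩ := isUnit_iff_exists_inv.1 hu
        have hb' : a⁻¹ * (b : L) = 1 := congrArg Subtype.val hb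
        have : (b : L) = a := by
          rw [← inv_inv a]
          exact (inv_eq_of_mul_eq_one_right hb').symm
        exact this ▸ b.2
  refine IsDiscreteValuationRing.not_isField V ?_
  have hV : ∀ z : K, z ∈ V := by
    intro z
    have hz : IsIntegral L z := Algebra.IsIntegral.isIntegral z
    let _ : Algebra L V := ((algebraMap L K).codRestrict V hL).toAlgebra
    have : IsScalarTower L V K := IsScalarTower.of_algebraMap_eq fun _ => rfl
    obtain ⟨w, hw⟩ := IsIntegrallyClosed.isIntegral_iff.1 (hz.tower_top (A := V))
    exact hw ▸ w.2
  refine ⟨⟨0, 1, zero_ne_one⟩, mul_comm, fun {a} ha => ⟨⟨(a : K)⁻¹, hV _⟩, Subtype.ext ?_⟩⟩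
  exact mul_inv_cancel₀ fun h => ha (Subtype.ext h)

/-- The point `π(P)` of the curve of `L` below a point `P` of the curve of `K`, for `K / L`
algebraic: its valuation ring is `𝒪_P ∩ L`. -/
def Point.below [Algebra.IsAlgebraic L K] (P : Point k K) : Point k L where
  ring := P.ring.comap (algebraMap L K)
  const_mem c := by
    rw [ValuationSubring.mem_comap, ← IsScalarTower.algebraMap_apply]
    exact P.const_mem c
  isDVR := isDVR_comap L P.ring

/-- The inertia degree of `P` over `L`: the degree of the residue field of `P` over the residue
field of the point below. -/
def Point.inertiaDegree (P : Point k K) : ℕ :=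
  letI := (IsLocalRing.ResidueField.map (comapHom L P.ring)).toAlgebra
  Module.finrank (IsLocalRing.ResidueField (P.ring.comap (algebraMap L K)))
    (IsLocalRing.ResidueField P.ring)

/-- The norm `∑ aᵢ Pᵢ ↦ ∑ aᵢ f(Pᵢ / π(Pᵢ)) π(Pᵢ)` from divisors of `K` to divisors of `L`. -/
def divisorNorm [Algebra.IsAlgebraic L K] : Divisor k K →+ Divisor k L :=
  Finsupp.liftAddHom fun P =>
    (Finsupp.singleAddHom (P.below L)).comp
      (AddMonoidHom.mulRight (P.inertiaDegree L : ℤ))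

end Below

/-! ### The rational function field -/

section Rational

variable {k : Type u} [Field k]

open Classical in
/-- The rational function assigned to a point of the projective line: the monic irreducible
polynomial that vanishes at the point (that is, the minimal polynomial over `k` of the value of
`x` in the residue field) when the point is finite, and `1 / x` for the point at infinity. -/
def pointFunction (Q : Point k (RatFunc k)) : RatFunc k :=
  if h : RatFunc.X ∈ Q.ring then
    algebraMap k[X] (RatFunc k) (minpoly k (IsLocalRing.residue Q.ring ⟨RatFunc.X, h⟩))
  else RatFunc.X⁻¹

/-- The multiplicative extension of `pointFunction` to all divisors of `k(x)`. -/
def divisorFunction (D : Divisor k (RatFunc k)) : RatFunc k :=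
  D.prod fun Q n => pointFunction Q ^ n

/-- The norm `n : Div K → k(x)ˣ` of divisors, as an element of `k(x)`. -/
def divisorNormFunction {K : Type v} [Field K] [Algebra k K] [Algebra (RatFunc k) K]
    [IsScalarTower k (RatFunc k) K] [Algebra.IsAlgebraic (RatFunc k) K]
    (D : Divisor k K) : RatFunc k :=
  divisorFunction (divisorNorm (RatFunc k) D)

/-- The affine plane curve `y² = f(x)` over `k` is smooth (Jacobian criterion): the partial
derivatives `-f'(x)` and `2y` of `y² - f(x)` have no common zero on it over the algebraic
closure of `k`. -/
def IsSmoothAffineCurve (f : k[X]) : Prop :=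
  ∀ a b : AlgebraicClosure k, b ^ 2 = aeval a f →
    ¬ (aeval a (derivative f) = 0 ∧ 2 * b = 0)

/-- `K` is the function field of the curve `y² = f(x)`, as an extension of `k(x)`:
it is generated over `k(x)` by a square root `y` of `f(x)`. -/
def IsFunctionFieldOf (f : k[X]) (K : Type v) [Field K] [Algebra (RatFunc k) K] : Prop :=
  ∃ y : K, y ^ 2 = algebraMap (RatFunc k) K (algebraMap k[X] (RatFunc k) f) ∧
    IntermediateField.adjoin (RatFunc k) {y} = ⊤

end Rational

end FunctionFieldCurve

end

/-! Write `σ` for the conjugation `y ↦ -y`, `N` for the norm `z ↦ z · σ z`, and `p` for the monic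
irreducible polynomial below `P`. The class of `P` is divisible by two exactly when some `w ≠ 0` has
a divisor congruent to `P` modulo two (`exists_picClass_eq_two_smul_iff`). As `deg f` is odd, a
point at infinity has degree one and rational functions have even valuation there; so a point of
even degree is finite, and it is ramified, split or inert (`ramified_or_split_or_inert`).

If `P` is inert, both conditions hold: `n P = p² = N(p)`, and the divisor of `p` is congruent to
`P`. Otherwise `n P = p` and `deg p = deg P` is even.

Given `w`, comparing valuations on each fibre shows that `p · N(w)` has even order at every finite
place, so it is a constant `c` times a square. The crux is that `c` is a square: `N(w) = a² - f b²`
has even degree and `deg f` is odd, so the leading coefficient comes from `a²`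
(`isSquare_of_mul_eq_C_mul_sq`). Hence `p` is a square times `N(w⁻¹)`, which is a norm
(`exists_norm_eq_of_even`).

Conversely, let `p = N(a)`. Then the valuations of `a` at `R` and `σR` add up to that of `p`. So
`div a - P` is even at ramified and inert points and has the same parity at the two points of a
split fibre; multiplying `a` by the polynomials below the odd split fibres makes it even everywhere
(`exists_even_of_norm_eq`). -/

namespace FunctionFieldCurve

universe u v

/-! ### Valuations at a point and the action of automorphisms -/

namespace Point

variable {k : Type u} {K : Type v} [Field k] [Field K] [Algebra k K]

lemma mem_ring_iff_valuation (P : Point k K) (a : K) :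
    a ∈ P.ring ↔ (IsDiscreteValuationRing.maximalIdeal P.ring).valuation K a ≤ 1 := by
  constructor
  · intro h
    exact IsDedekindDomain.HeightOneSpectrum.valuation_le_one _ (⟨a, h⟩ : P.ring)
  · intro h
    obtain ⟨b, hb⟩ := IsDiscreteValuationRing.exists_lift_of_le_one h
    exact hb ▸ b.2

/-- The valuation of `a` at `P` is at least `n` (with the valuation of `0` infinite). -/
def OrdGE (P : Point k K) (n : ℤ) (a : K) : Prop := a = 0 ∨ n ≤ P.ord a

lemma ordGE_iff_valuation (P : Point k K) (n : ℤ) (a : K) :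
    P.OrdGE n a ↔
      (IsDiscreteValuationRing.maximalIdeal P.ring).valuation K a ≤ WithZero.exp (-n) := by
  by_cases ha : a = 0
  · simp [OrdGE, ha]
  · rw [← WithZero.log_le_iff_le_exp ((Valuation.ne_zero_iff _).2 ha)]
    simp only [OrdGE, ha, false_or, ord]
    constructor <;> intro h <;> linarith

lemma OrdGE.add {P : Point k K} {n : ℤ} {a b : K} (ha : P.OrdGE n a) (hb : P.OrdGE n b) :
    P.OrdGE n (a + b) := by
  rw [ordGE_iff_valuation] at *
  exact (Valuation.map_add _ _ _).trans (max_le ha hb)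

lemma ord_neg (P : Point k K) (a : K) : P.ord (-a) = P.ord a := by
  simp [ord, Valuation.map_neg]

lemma ord_zero (P : Point k K) : P.ord 0 = 0 := by simp [ord]

lemma OrdGE.neg {P : Point k K} {n : ℤ} {a : K} (ha : P.OrdGE n a) : P.OrdGE n (-a) := by
  rcases ha with h | h
  · exact Or.inl (by simp [h])
  · exact Or.inr (by rwa [ord_neg])

lemma OrdGE.sub {P : Point k K} {n : ℤ} {a b : K} (ha : P.OrdGE n a) (hb : P.OrdGE n b) :
    P.OrdGE n (a - b) := by
  rw [sub_eq_add_neg]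
  exact ha.add hb.neg

lemma OrdGE.mul {P : Point k K} {m n : ℤ} {a b : K} (ha : P.OrdGE m a) (hb : P.OrdGE n b) :
    P.OrdGE (m + n) (a * b) := by
  by_cases ha0 : a = 0
  · exact Or.inl (by simp [ha0])
  by_cases hb0 : b = 0
  · exact Or.inl (by simp [hb0])
  have h1 := ha.resolve_left ha0
  have h2 := hb.resolve_left hb0
  exact Or.inr (by rw [P.ord_mul ha0 hb0]; linarith)

lemma OrdGE.mono {P : Point k K} {m n : ℤ} {a : K} (ha : P.OrdGE m a) (h : n ≤ m) :
    P.OrdGE n a := ha.imp id h.trans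

lemma ordGE_zero (P : Point k K) (n : ℤ) : P.OrdGE n 0 := Or.inl rfl

lemma ordGE_ord (P : Point k K) (a : K) : P.OrdGE (P.ord a) a := Or.inr le_rfl

lemma OrdGE.sum {P : Point k K} {n : ℤ} {ι : Type*} (s : Finset ι) (F : ι → K)
    (h : ∀ i ∈ s, P.OrdGE n (F i)) : P.OrdGE n (∑ i ∈ s, F i) := by
  classical
  induction s using Finset.induction_on with
  | empty => exact Or.inl (by simp)
  | insert i s hi ih =>
    rw [Finset.sum_insert hi]
    exact (h i (by simp)).add (ih fun j hj => h j (by simp [hj]))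

lemma mem_ring_iff (P : Point k K) (a : K) : a ∈ P.ring ↔ P.OrdGE 0 a := by
  rw [mem_ring_iff_valuation, ordGE_iff_valuation]
  simp

/-- The junk value `P.ord 0 = 0` is harmless at this threshold; for other bounds `OrdGE` is needed.
-/
lemma mem_ring_iff_ord (P : Point k K) (a : K) : a ∈ P.ring ↔ 0 ≤ P.ord a := by
  rw [mem_ring_iff, OrdGE]
  constructor
  · rintro (rfl | h)
    · rw [ord_zero]
    · exact h
  · exact Or.inr

/-- The strict triangle inequality is an equality when the two valuations differ. -/
lemma ord_add_eq_of_lt (P : Point k K) {a b : K} (ha : a ≠ 0) (hb : P.OrdGE (P.ord a + 1) b) :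
    a + b ≠ 0 ∧ P.ord (a + b) = P.ord a := by
  have h0 : a + b ≠ 0 := by
    intro h
    have hb' : b = -a := by linear_combination h
    rw [hb'] at hb
    rcases hb with h | h
    · exact ha (neg_eq_zero.1 h)
    · rw [ord_neg] at h; linarith
  refine ⟨h0, le_antisymm ?_ ?_⟩
  · by_contra hlt
    have h1 : P.OrdGE (P.ord a + 1) (a + b) := Or.inr (by omega)
    have h2 := (h1.sub hb).resolve_left (by simpa using ha)
    rw [add_sub_cancel_right] at h2
    omega
  · exact (((P.ordGE_ord a).add (hb.mono (by omega))).resolve_left h0)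

lemma ord_pow (P : Point k K) (a : K) (n : ℕ) : P.ord (a ^ n) = n * P.ord a := by
  simp [ord, WithZero.log_pow]

lemma ord_zpow (P : Point k K) (a : K) (n : ℤ) : P.ord (a ^ n) = n * P.ord a := by
  simp [ord, WithZero.log_zpow]

lemma ord_div (P : Point k K) {a b : K} (ha : a ≠ 0) (hb : b ≠ 0) :
    P.ord (a / b) = P.ord a - P.ord b := by
  rw [div_eq_mul_inv, P.ord_mul ha (inv_ne_zero hb), ord_inv, sub_eq_add_neg]

lemma ord_prod (P : Point k K) {ι : Type*} (s : Finset ι) (F : ι → K)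
    (h : ∀ i ∈ s, F i ≠ 0) : P.ord (∏ i ∈ s, F i) = ∑ i ∈ s, P.ord (F i) := by
  classical
  induction s using Finset.induction_on with
  | empty => simp [ord_one]
  | insert i s hi ih =>
    rw [Finset.prod_insert hi, Finset.sum_insert hi, P.ord_mul (h i (by simp))
      (Finset.prod_ne_zero_iff.2 fun j hj => h j (by simp [hj])),
      ih fun j hj => h j (by simp [hj])]

lemma exists_ord_eq_one (P : Point k K) : ∃ a : K, a ≠ 0 ∧ P.ord a = 1 := by
  obtain ⟨a, ha⟩ := (IsDiscreteValuationRing.maximalIdeal P.ring).valuation_exists_uniformizer K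
  refine ⟨a, ?_, ?_⟩
  · rintro rfl
    rw [map_zero] at ha
    exact WithZero.exp_ne_zero ha.symm
  · rw [ord, ha]
    rfl

lemma ord_algebraMap (P : Point k K) (c : k) : P.ord (algebraMap k K c) = 0 := by
  by_cases hc : c = 0
  · simp [hc, ord_zero]
  · have h1 := (P.mem_ring_iff_ord _).1 (P.const_mem c)
    have h2 := (P.mem_ring_iff_ord _).1 (P.const_mem c⁻¹)
    rw [map_inv₀, ord_inv] at h2
    linarith

lemma ord_two (P : Point k K) : P.ord (2 : K) = 0 := by
  have := P.ord_algebraMap 2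
  rwa [map_ofNat] at this

lemma OrdGE.ord_eq_zero {P : Point k K} {a : K} (h : P.OrdGE 0 a) (h1 : ¬ P.OrdGE 1 a) :
    a ≠ 0 ∧ P.ord a = 0 := by
  simp only [OrdGE, not_or] at h1
  have := h.resolve_left h1.1
  exact ⟨h1.1, by omega⟩

lemma not_ordGE_one_of_ord_eq_zero {P : Point k K} {a : K} (h0 : a ≠ 0) (h : P.ord a = 0) :
    ¬ P.OrdGE 1 a := by
  simp [OrdGE, h0, h]

lemma mem_maximalIdeal_iff (P : Point k K) (a : P.ring) :
    a ∈ IsLocalRing.maximalIdeal P.ring ↔ P.OrdGE 1 (a : K) := by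
  rw [ordGE_iff_valuation]
  have h := (IsDiscreteValuationRing.maximalIdeal P.ring).valuation_lt_one_iff_mem
    (K := K) a
  have h2 : (IsDiscreteValuationRing.maximalIdeal P.ring).asIdeal =
    IsLocalRing.maximalIdeal P.ring := rfl
  rw [h2] at h
  rw [← h]
  by_cases ha : (a : K) = 0
  · have : a = 0 := Subtype.ext ha
    subst this
    simp
  · have hne := ((Valuation.ne_zero_iff
      ((IsDiscreteValuationRing.maximalIdeal P.ring).valuation K)).2 ha)
    rw [← WithZero.log_le_iff_le_exp hne]
    change ((IsDiscreteValuationRing.maximalIdeal P.ring).valuation K) (a : K) < 1 ↔ _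
    rw [← WithZero.exp_zero, ← WithZero.log_lt_iff_lt_exp hne]
    omega

lemma residue_eq_iff (P : Point k K) (a b : P.ring) :
    IsLocalRing.residue P.ring a = IsLocalRing.residue P.ring b ↔ P.OrdGE 1 ((a : K) - b) := by
  rw [← sub_eq_zero, ← map_sub, IsLocalRing.residue_eq_zero_iff, mem_maximalIdeal_iff]
  rfl

lemma residue_surjective (P : Point k K) (r : P.residueField) :
    ∃ w : K, ∃ hw : w ∈ P.ring, IsLocalRing.residue P.ring ⟨w, hw⟩ = r := by
  obtain ⟨⟨w, hw⟩, h⟩ := IsLocalRing.residue_surjective (R := P.ring) r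
  exact ⟨w, hw, h⟩

/-- The normalized valuation is the only surjective homomorphism to `ℤ` that is nonnegative
exactly on the valuation ring. -/
lemma eq_ord_of_nonneg_iff (P : Point k K) (o : K → ℤ)
    (hmul : ∀ a b, a ≠ 0 → b ≠ 0 → o (a * b) = o a + o b)
    (hmem : ∀ a, a ≠ 0 → (0 ≤ o a ↔ a ∈ P.ring)) (hone : ∃ a, a ≠ 0 ∧ o a = 1)
    {a : K} (ha : a ≠ 0) : o a = P.ord a := by
  have h1 : o 1 = 0 := by
    have := hmul 1 1 one_ne_zero one_ne_zero
    rw [mul_one] at this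
    linarith
  have hinv : ∀ a, a ≠ 0 → o a⁻¹ = -o a := fun a ha => by
    have := hmul a a⁻¹ ha (inv_ne_zero ha)
    rw [mul_inv_cancel₀ ha, h1] at this
    linarith
  have hunit : ∀ a, a ≠ 0 → P.ord a = 0 → o a = 0 := fun a ha h => by
    have e1 := (hmem a ha).2 ((P.mem_ring_iff_ord a).2 h.ge)
    have e2 := (hmem a⁻¹ (inv_ne_zero ha)).2 ((P.mem_ring_iff_ord _).2 (by rw [ord_inv, h]; simp))
    rw [hinv a ha] at e2
    linarith
  obtain ⟨t, ht0, ht⟩ := P.exists_ord_eq_one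
  have hzpow : ∀ n : ℤ, o (t ^ n) = n * o t := by
    have hpow : ∀ n : ℕ, o (t ^ n) = n * o t := fun n => by
      induction n with
      | zero => simp [h1]
      | succ n ih =>
        rw [pow_succ, hmul _ _ (pow_ne_zero _ ht0) ht0, ih]
        push_cast; ring
    intro n
    obtain ⟨m, rfl | rfl⟩ := n.eq_nat_or_neg
    · rw [zpow_natCast, hpow]
    · rw [zpow_neg, zpow_natCast, hinv _ (pow_ne_zero _ ht0), hpow]; ring
  -- Every element is a unit times a power of the uniformizer `t`, so `o` is a multiple of `P.ord`;
  -- surjectivity and the sign condition then force the factor `o t` to be `1`.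
  have key : ∀ a, a ≠ 0 → o a = P.ord a * o t := fun a ha => by
    have h2 : t ^ P.ord a ≠ 0 := zpow_ne_zero _ ht0
    have h3 : a / t ^ P.ord a ≠ 0 := div_ne_zero ha h2
    have h4 := hunit _ h3 (by rw [ord_div _ ha h2, ord_zpow, ht]; ring)
    have h5 := hmul _ _ h3 h2
    rw [div_mul_cancel₀ _ h2, h4, hzpow] at h5
    linarith
  obtain ⟨b, hb0, hb⟩ := hone
  have e1 := key b hb0
  have e2 : 0 ≤ o t := (hmem t ht0).2 ((P.mem_ring_iff_ord t).2 (by omega))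
  rw [hb] at e1
  have e3 : o t = 1 := by
    have : o t ∣ 1 := ⟨P.ord b, by linarith⟩
    exact Int.eq_one_of_dvd_one e2 this
  rw [key a ha, e3, mul_one]

lemma ext_ord {P R : Point k K} (h : ∀ a, a ≠ 0 → (0 ≤ P.ord a ↔ 0 ≤ R.ord a)) : P = R := by
  ext a
  rw [mem_ring_iff, mem_ring_iff, OrdGE, OrdGE]
  by_cases ha : a = 0
  · simp [ha]
  · simp [ha, h a ha]

/-- The image of a point under (the inverse of) a field automorphism over `k`. -/
def conj (σ : K ≃ₐ[k] K) (P : Point k K) : Point k K where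
  ring := P.ring.comap (σ : K →+* K)
  const_mem c := by
    rw [ValuationSubring.mem_comap]
    change σ (algebraMap k K c) ∈ _
    rw [AlgEquiv.commutes]
    exact P.const_mem c
  isDVR := by
    have e : P.ring.comap (σ : K →+* K) ≃+* P.ring :=
      { toFun := fun a => ⟨σ a, a.2⟩
        invFun := fun a => ⟨σ.symm a, by
          rw [ValuationSubring.mem_comap]
          change σ (σ.symm (a : K)) ∈ _
          rw [AlgEquiv.apply_symm_apply]
          exact a.2⟩
        left_inv := fun a => Subtype.ext (by simp)
        right_inv := fun a => Subtype.ext (by simp)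
        map_mul' := fun a b => Subtype.ext (by simp)
        map_add' := fun a b => Subtype.ext (by simp) }
    exact IsDiscreteValuationRing.RingEquivClass.isDiscreteValuationRing e.symm

lemma mem_conj_ring (σ : K ≃ₐ[k] K) (P : Point k K) (a : K) :
    a ∈ (P.conj σ).ring ↔ σ a ∈ P.ring := Iff.rfl

lemma ord_conj (σ : K ≃ₐ[k] K) (P : Point k K) (a : K) : (P.conj σ).ord a = P.ord (σ a) := by
  by_cases ha : a = 0
  · simp [ha, ord_zero]
  refine (eq_ord_of_nonneg_iff _ (fun a => P.ord (σ a)) ?_ ?_ ?_ ha).symm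
  · intro a b ha hb
    simp only [map_mul]
    exact P.ord_mul (by simpa using ha) (by simpa using hb)
  · intro a _
    rw [mem_conj_ring, mem_ring_iff_ord]
  · obtain ⟨t, ht0, ht⟩ := P.exists_ord_eq_one
    exact ⟨σ.symm t, by simpa using ht0, by simpa using ht⟩

end Point

end FunctionFieldCurve

/-! ### Quadratic extensions and the double cover -/

namespace FunctionFieldCurve

universe u v

section Quadratic

variable {L : Type u} {K : Type v} [Field L] [Field K] [Algebra L K]

lemma minpoly_eq_X_sq_sub_C {d : L} (hd : ¬ IsSquare d) {y : K}
    (hy : y ^ 2 = algebraMap L K d) : minpoly L y = X ^ 2 - C d := by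
  symm
  refine minpoly.eq_of_irreducible_of_monic ?_ ?_ (monic_X_pow_sub_C d two_ne_zero)
  · refine X_pow_sub_C_irreducible_of_prime Nat.prime_two fun b hb => hd ⟨b, ?_⟩
    rw [← hb, sq]
  · simp [hy]

lemma exists_eq_add_mul {d : L} {y : K} (hy : y ^ 2 = algebraMap L K d)
    (hgen : IntermediateField.adjoin L {y} = ⊤) (w : K) :
    ∃ a b : L, w = algebraMap L K a + algebraMap L K b * y := by
  have hm : (X ^ 2 - C d : L[X]).Monic := monic_X_pow_sub_C d two_ne_zero
  have haev : aeval y (X ^ 2 - C d : L[X]) = 0 := by simp [hy]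
  have hint : IsIntegral L y := ⟨_, hm, haev⟩
  have hw : w ∈ IntermediateField.adjoin L {y} := hgen ▸ IntermediateField.mem_top
  rw [← IntermediateField.mem_toSubalgebra,
    IntermediateField.adjoin_simple_toSubalgebra_of_isAlgebraic hint.isAlgebraic,
    Algebra.adjoin_singleton_eq_range_aeval] at hw
  obtain ⟨g, rfl⟩ := hw
  have hdeg : (g %ₘ (X ^ 2 - C d)).degree ≤ 1 := by
    have h := degree_modByMonic_lt g hm
    rw [degree_X_pow_sub_C two_pos d] at h
    refine degree_le_iff_coeff_zero _ _ |>.2 fun m hm =>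
      coeff_eq_zero_of_degree_lt (h.trans_le ?_)
    exact_mod_cast hm
  refine ⟨(g %ₘ (X ^ 2 - C d)).coeff 0, (g %ₘ (X ^ 2 - C d)).coeff 1, ?_⟩
  change aeval y g = _
  rw [← aeval_modByMonic_eq_self_of_root haev, eq_X_add_C_of_degree_le_one hdeg]
  simp [add_comm]

lemma exists_conjugation {d : L} (hd : ¬ IsSquare d) {y : K}
    (hy : y ^ 2 = algebraMap L K d) (hgen : IntermediateField.adjoin L {y} = ⊤) :
    ∃ σ : K ≃ₐ[L] K, σ y = -y := by
  have hmin := minpoly_eq_X_sq_sub_C hd hy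
  have hint : IsIntegral L y := ⟨_, monic_X_pow_sub_C d two_ne_zero, by simp [hy]⟩
  have hadj : Algebra.adjoin L {y} = ⊤ := by
    rw [← IntermediateField.adjoin_simple_toSubalgebra_of_isAlgebraic hint.isAlgebraic, hgen]
    rfl
  let pb := PowerBasis.ofAdjoinEqTop' hint hadj
  have hpb : pb.gen = y := PowerBasis.ofAdjoinEqTop'_gen hint hadj
  -- The conjugation sends `y` to the other root of `X² - d`; it is bijective because it is its own
  -- inverse.
  have hroot : aeval (-y) (minpoly L pb.gen) = 0 := by
    rw [hpb, hmin]
    simp [hy]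
  let s : K →ₐ[L] K := pb.lift (-y) hroot
  have hs : s y = -y := by
    have := pb.lift_gen (-y) hroot
    rwa [hpb] at this
  have hss : s.comp s = AlgHom.id L K := by
    apply pb.algHom_ext
    rw [hpb]
    simp [hs]
  exact ⟨AlgEquiv.ofAlgHom s s hss hss, hs⟩

/-- In the basis `1, y`, multiplication by `a + b y` has columns `(a, b)` and `(d b, a)`; the norm
is the determinant. -/
lemma algebraMap_norm_eq_mul_conj {d : L} (hd : ¬ IsSquare d) {y : K}
    (hy : y ^ 2 = algebraMap L K d) (hgen : IntermediateField.adjoin L {y} = ⊤)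
    (a b : L) :
    Algebra.norm L (algebraMap L K a + algebraMap L K b * y) = a ^ 2 - d * b ^ 2 := by
  have hli : LinearIndependent L ![(1 : K), y] := by
    rw [LinearIndependent.pair_iff]
    intro s t h
    rw [Algebra.smul_def, Algebra.smul_def, mul_one] at h
    by_cases ht : t = 0
    · subst ht
      simpa using h
    -- A relation with `t ≠ 0` would put `y` into `L` and make `d` a square.
    · refine absurd ⟨s / t, ?_⟩ hd
      apply (algebraMap L K).injective
      have ht' : algebraMap L K t ≠ 0 := by simpa using ht
      have hy' : y = -(algebraMap L K s / algebraMap L K t) := by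
        field_simp
        linear_combination h
      rw [← hy, map_mul, map_div₀, hy']
      ring
  have hsp : ⊤ ≤ Submodule.span L (Set.range ![(1 : K), y]) := by
    intro w _
    obtain ⟨a, b, rfl⟩ := exists_eq_add_mul hy hgen w
    rw [Matrix.range_cons, Matrix.range_cons, Matrix.range_empty, Set.union_empty,
      Set.singleton_union, Submodule.mem_span_pair]
    exact ⟨a, b, by simp [Algebra.smul_def]⟩
  let B := Module.Basis.mk hli hsp
  have hB0 : B 0 = 1 := by simp [B]
  have hB1 : B 1 = y := by simp [B]
  have e0 : (algebraMap L K a + algebraMap L K b * y) * B 0 = a • B 0 + b • B 1 := by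
    rw [hB0, hB1]; simp [Algebra.smul_def]
  have e1 : (algebraMap L K a + algebraMap L K b * y) * B 1 = (d * b) • B 0 + a • B 1 := by
    rw [hB0, hB1]; simp [Algebra.smul_def, ← hy]; ring
  rw [Algebra.norm_eq_matrix_det B, Matrix.det_fin_two]
  simp only [Algebra.leftMulMatrix_eq_repr_mul, e0, e1, map_add, map_smul, Module.Basis.repr_self,
    Finsupp.add_apply, Finsupp.smul_apply]
  simp
  ring

end Quadratic

lemma not_isSquare_of_odd_natDegree {k : Type u} [Field k] {f : k[X]} (hf : Odd f.natDegree) :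
    ¬ IsSquare (algebraMap k[X] (RatFunc k) f) := by
  rintro ⟨r, hr⟩
  have hf0 : f ≠ 0 := by rintro rfl; simp at hf
  have hr0 : r ≠ 0 := by
    rintro rfl
    simp [hf0] at hr
  have h := congrArg RatFunc.intDegree hr
  rw [RatFunc.intDegree_polynomial, RatFunc.intDegree_mul hr0 hr0] at h
  have : Even (f.natDegree : ℤ) := ⟨_, h⟩
  rw [Int.even_coe_nat] at this
  exact (Nat.not_even_iff_odd.2 hf) this

/-- At a root `a` of a repeated factor both `f` and its derivative vanish, so `(a, 0)` would be a
singular point. -/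
lemma IsSmoothAffineCurve.not_sq_dvd {k : Type u} [Field k] {f : k[X]}
    (h : IsSmoothAffineCurve f) {q : k[X]} (hq : Irreducible q) : ¬ q ^ 2 ∣ f := by
  rintro ⟨g, rfl⟩
  obtain ⟨a, ha⟩ := IsAlgClosed.exists_aeval_eq_zero (AlgebraicClosure k) q
    (Polynomial.degree_pos_of_irreducible hq).ne'
  refine h a 0 ?_ ⟨?_, by simp⟩
  · simp [ha]
  · simp [ha, derivative_mul, derivative_pow]

/-- `K` is the extension of `k(x)` generated by a square root `y` of the squarefree polynomial `f`
of odd degree, the characteristic is not two, and `σ` is the nontrivial automorphism of the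
extension. -/
structure IsDoubleCover {k : Type u} [Field k] {K : Type v} [Field K] [Algebra k K]
    [Algebra (RatFunc k) K] (f : k[X]) (y : K) (σ : K ≃ₐ[k] K) : Prop where
  two_ne_zero : (2 : k) ≠ 0
  odd_natDegree : Odd f.natDegree
  not_sq_dvd (q : k[X]) (hq : Irreducible q) : ¬ q ^ 2 ∣ f
  sq_eq : y ^ 2 = algebraMap (RatFunc k) K (algebraMap k[X] (RatFunc k) f)
  exists_eq (w : K) :
    ∃ a b : RatFunc k, w = algebraMap (RatFunc k) K a + algebraMap (RatFunc k) K b * y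
  -- `σ` is typed as `k`-linear so that it acts on points through `Point.conj`; this field records
  -- that it fixes `k(x)`.
  conj_algebraMap (a : RatFunc k) : σ (algebraMap (RatFunc k) K a) = algebraMap (RatFunc k) K a
  conj_y : σ y = -y
  norm_eq (a b : RatFunc k) :
    Algebra.norm (RatFunc k) (algebraMap (RatFunc k) K a + algebraMap (RatFunc k) K b * y) =
      a ^ 2 - algebraMap k[X] (RatFunc k) f * b ^ 2

lemma IsFunctionFieldOf.exists_isDoubleCover {k : Type u} [Field k] {K : Type v} [Field K]
    [Algebra k K] [Algebra (RatFunc k) K] [IsScalarTower k (RatFunc k) K] {f : k[X]}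
    (hK : IsFunctionFieldOf f K) (hchar : (2 : k) ≠ 0) (hdeg : Odd f.natDegree)
    (hsmooth : IsSmoothAffineCurve f) : ∃ (y : K) (σ : K ≃ₐ[k] K), IsDoubleCover f y σ := by
  obtain ⟨y, hy, hgen⟩ := hK
  have hd := not_isSquare_of_odd_natDegree hdeg
  obtain ⟨σ, hσ⟩ := exists_conjugation hd hy hgen
  exact ⟨y, σ.restrictScalars k, hchar, hdeg, fun _ => hsmooth.not_sq_dvd, hy, exists_eq_add_mul hy hgen, σ.commutes, hσ,
    algebraMap_norm_eq_mul_conj hd hy hgen⟩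

namespace IsDoubleCover

variable {k : Type u} [Field k] {K : Type v} [Field K] [Algebra k K]
  [Algebra (RatFunc k) K] {f : k[X]} {y : K} {σ : K ≃ₐ[k] K}

lemma algebraMap_norm (h : IsDoubleCover f y σ) (w : K) :
    algebraMap (RatFunc k) K (Algebra.norm (RatFunc k) w) = w * σ w := by
  obtain ⟨a, b, rfl⟩ := h.exists_eq w
  rw [h.norm_eq, map_add, map_mul, h.conj_algebraMap, h.conj_algebraMap, h.conj_y]
  simp only [map_sub, map_pow, map_mul, ← h.sq_eq]
  ring

lemma poly_ne_zero (h : IsDoubleCover f y σ) : f ≠ 0 := by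
  rintro rfl
  simpa using h.odd_natDegree

lemma y_ne_zero (h : IsDoubleCover f y σ) : y ≠ 0 := by
  have h1 := h.sq_eq
  rintro rfl
  simp only [ne_eq, OfNat.ofNat_ne_zero, not_false_eq_true, zero_pow] at h1
  simpa [h.poly_ne_zero] using h1.symm

lemma conj_conj (h : IsDoubleCover f y σ) (w : K) : σ (σ w) = w := by
  obtain ⟨a, b, rfl⟩ := h.exists_eq w
  simp [h.conj_algebraMap, h.conj_y]

end IsDoubleCover

end FunctionFieldCurve

/-! ### Points over the affine line and over infinity -/

namespace FunctionFieldCurve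

universe u v

variable {k : Type u} [Field k]

/-- The inclusion of the polynomial ring `k[x]` into an extension of `k(x)`. -/
noncomputable def polyMap (K : Type v) [Field K] [Algebra (RatFunc k) K] : k[X] →+* K :=
  (algebraMap (RatFunc k) K).comp (algebraMap k[X] (RatFunc k))

variable {K : Type v} [Field K] [Algebra (RatFunc k) K]

lemma polyMap_apply (g : k[X]) :
    polyMap K g = algebraMap (RatFunc k) K (algebraMap k[X] (RatFunc k) g) := rfl

lemma polyMap_ne_zero {g : k[X]} (hg : g ≠ 0) : polyMap K g ≠ 0 := by
  rw [polyMap_apply]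
  simpa using hg

lemma exists_algebraMap_eq_div {a : RatFunc k} (ha : a ≠ 0) :
    ∃ g h : k[X], g ≠ 0 ∧ h ≠ 0 ∧ algebraMap (RatFunc k) K a = polyMap K g / polyMap K h := by
  refine ⟨a.num, a.denom, RatFunc.num_ne_zero ha, a.denom_ne_zero, ?_⟩
  rw [polyMap_apply, polyMap_apply, ← map_div₀, RatFunc.num_div_denom]

section Tower

variable [Algebra k K] [IsScalarTower k (RatFunc k) K]

lemma polyMap_C (c : k) : polyMap K (C c) = algebraMap k K c := by
  rw [polyMap_apply, IsScalarTower.algebraMap_apply k (RatFunc k) K, RatFunc.algebraMap_eq_C,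
    RatFunc.algebraMap_C]

lemma polyMap_eq_aeval (g : k[X]) : polyMap K g = aeval (polyMap K (X : k[X])) g := by
  rw [aeval_def, eval₂_eq_sum_range]
  conv_lhs => rw [g.as_sum_range_C_mul_X_pow]
  simp [polyMap_C]

end Tower

namespace Point

variable [Algebra k K]

/-- `P` is a point of `K` above the zero of the monic irreducible polynomial `q` on the affine
line. -/
structure LiesOver (P : Point k K) (q : k[X]) : Prop where
  monic : q.Monic
  irreducible : Irreducible q
  X_mem : polyMap K (X : k[X]) ∈ P.ring
  ordGE_one : P.OrdGE 1 (polyMap K q)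

lemma LiesOver.ord_pos {P : Point k K} {q : k[X]} (h : P.LiesOver q) : 0 < P.ord (polyMap K q) := by
  have := h.ordGE_one.resolve_left (polyMap_ne_zero h.irreducible.ne_zero)
  omega

variable [IsScalarTower k (RatFunc k) K]

lemma polyMap_mem {P : Point k K} (hX : polyMap K (X : k[X]) ∈ P.ring) (g : k[X]) :
    polyMap K g ∈ P.ring := by
  have h : polyMap K g = ((aeval (⟨_, hX⟩ : P.ring) g : P.ring) : K) := by
    rw [polyMap_eq_aeval]
    exact (aeval_algebraMap_apply K (⟨_, hX⟩ : P.ring) g)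
  rw [h]
  exact Subtype.property _

lemma residue_polyMap {P : Point k K} (hX : polyMap K (X : k[X]) ∈ P.ring) (g : k[X]) :
    IsLocalRing.residue P.ring ⟨polyMap K g, polyMap_mem hX g⟩ =
      aeval (IsLocalRing.residue P.ring ⟨_, hX⟩) g := by
  have h : (⟨polyMap K g, polyMap_mem hX g⟩ : P.ring) = aeval (⟨_, hX⟩ : P.ring) g := by
    apply Subtype.ext
    change polyMap K g = _
    rw [polyMap_eq_aeval]
    exact (aeval_algebraMap_apply K (⟨_, hX⟩ : P.ring) g)
  rw [h]
  exact (aeval_algebraMap_apply P.residueField (⟨_, hX⟩ : P.ring) g).symm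

lemma aeval_residue_eq_zero_iff {P : Point k K} (hX : polyMap K (X : k[X]) ∈ P.ring) (g : k[X]) :
    aeval (IsLocalRing.residue P.ring ⟨_, hX⟩) g = 0 ↔ P.OrdGE 1 (polyMap K g) := by
  rw [← residue_polyMap, IsLocalRing.residue_eq_zero_iff, mem_maximalIdeal_iff]

/-- A uniformizer of the point below works: if it were a unit at `P`, its inverse would lie in the
ring below. -/
lemma exists_algebraMap_ord_ne_zero [Algebra.IsAlgebraic (RatFunc k) K] (P : Point k K) :
    ∃ a : RatFunc k, a ≠ 0 ∧ P.ord (algebraMap (RatFunc k) K a) ≠ 0 := by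
  obtain ⟨t, ht0, ht⟩ := (P.below (RatFunc k)).exists_ord_eq_one
  refine ⟨t, ht0, fun h => ?_⟩
  have h1 : t⁻¹ ∈ (P.below (RatFunc k)).ring := by
    change algebraMap (RatFunc k) K t⁻¹ ∈ P.ring
    rw [mem_ring_iff_ord, map_inv₀, ord_inv, h]
    simp
  rw [mem_ring_iff_ord, ord_inv, ht] at h1
  omega

/-- Some nonzero polynomial vanishes at `P`, since otherwise the valuation would be trivial on
`k(x)`. So the residue of `x` is algebraic over `k`, and `q` is its minimal polynomial. -/
lemma exists_liesOver [Algebra.IsAlgebraic (RatFunc k) K] {P : Point k K}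
    (hX : polyMap K (X : k[X]) ∈ P.ring) : ∃ q, P.LiesOver q := by
  have hg : ∃ g : k[X], g ≠ 0 ∧ P.OrdGE 1 (polyMap K g) := by
    by_contra! hcon
    have hz : ∀ g : k[X], g ≠ 0 → P.ord (polyMap K g) = 0 := fun g hg => by
      have h1 := (P.mem_ring_iff_ord _).1 (polyMap_mem hX g)
      have h2 := hcon g hg
      simp only [OrdGE, polyMap_ne_zero hg, false_or] at h2
      omega
    obtain ⟨a, ha0, ha⟩ := P.exists_algebraMap_ord_ne_zero
    obtain ⟨g, h, hg, hh, e⟩ := exists_algebraMap_eq_div (K := K) ha0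
    rw [e, P.ord_div (polyMap_ne_zero hg) (polyMap_ne_zero hh), hz g hg, hz h hh] at ha
    simp at ha
  obtain ⟨g, hg0, hg⟩ := hg
  rw [← aeval_residue_eq_zero_iff hX] at hg
  have hint : IsIntegral k (IsLocalRing.residue P.ring ⟨_, hX⟩) :=
    IsAlgebraic.isIntegral ⟨g, hg0, hg⟩
  exact ⟨minpoly k (IsLocalRing.residue P.ring ⟨_, hX⟩), minpoly.monic hint,
    minpoly.irreducible hint, hX, (aeval_residue_eq_zero_iff hX _).1 (minpoly.aeval _ _)⟩

namespace LiesOver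

variable {P R : Point k K} {q : k[X]}

lemma minpoly_residue (h : P.LiesOver q) :
    minpoly k (IsLocalRing.residue P.ring ⟨_, h.X_mem⟩) = q :=
  (minpoly.eq_of_irreducible_of_monic h.irreducible
    ((aeval_residue_eq_zero_iff h.X_mem _).2 h.ordGE_one) h.monic).symm

lemma ordGE_one_iff_dvd (h : P.LiesOver q) (g : k[X]) :
    P.OrdGE 1 (polyMap K g) ↔ q ∣ g := by
  rw [← aeval_residue_eq_zero_iff h.X_mem, ← minpoly.dvd_iff, h.minpoly_residue]

lemma eq (h : P.LiesOver q) {q' : k[X]} (h' : P.LiesOver q') : q' = q := by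
  rw [← h.minpoly_residue, ← h'.minpoly_residue]

lemma ord_of_not_dvd (h : P.LiesOver q) {g : k[X]} (hg : ¬ q ∣ g) : P.ord (polyMap K g) = 0 := by
  rw [← h.ordGE_one_iff_dvd] at hg
  have h1 := (P.mem_ring_iff_ord _).1 (polyMap_mem h.X_mem g)
  simp only [OrdGE, not_or] at hg
  omega

/-- The factor `P.ord (polyMap K q)` plays the role of the ramification index. -/
lemma ord_polyMap (h : P.LiesOver q) {g : k[X]} (hg : g ≠ 0) :
    P.ord (polyMap K g) = P.ord (polyMap K q) * multiplicity q g := by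
  obtain ⟨c, hc, hc'⟩ := (FiniteMultiplicity.of_not_isUnit h.irreducible.not_isUnit
    hg).exists_eq_pow_mul_and_not_dvd
  have hc0 : c ≠ 0 := by rintro rfl; simp at hc'
  conv_lhs => rw [hc]
  rw [map_mul, P.ord_mul (polyMap_ne_zero (pow_ne_zero _ h.irreducible.ne_zero))
    (polyMap_ne_zero hc0), map_pow, ord_pow, h.ord_of_not_dvd hc']
  ring

/-- The integer `n` is the order of `a` at `q`. That it does not depend on `R` allows the points of
one fibre to be compared. -/
lemma exists_ord_algebraMap (q : k[X]) {a : RatFunc k} (ha : a ≠ 0) :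
    ∃ n : ℤ, ∀ R : Point k K, R.LiesOver q →
      R.ord (algebraMap (RatFunc k) K a) = R.ord (polyMap K q) * n := by
  obtain ⟨g₁, g₂, h1, h2, e⟩ := exists_algebraMap_eq_div (K := K) ha
  refine ⟨(multiplicity q g₁ : ℤ) - multiplicity q g₂, fun R hR => ?_⟩
  rw [e, R.ord_div (polyMap_ne_zero h1) (polyMap_ne_zero h2), hR.ord_polyMap h1,
    hR.ord_polyMap h2]
  ring

lemma ord_dvd (h : P.LiesOver q) (a : RatFunc k) :
    P.ord (polyMap K q) ∣ P.ord (algebraMap (RatFunc k) K a) := by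
  by_cases ha : a = 0
  · simp [ha, ord_zero]
  · obtain ⟨n, hn⟩ := exists_ord_algebraMap (K := K) q ha
    exact ⟨n, hn P h⟩

lemma ordGE_algebraMap_iff (h : P.LiesOver q) (hR : R.LiesOver q) (a : RatFunc k) :
    (P.OrdGE 0 (algebraMap (RatFunc k) K a) ↔ R.OrdGE 0 (algebraMap (RatFunc k) K a)) ∧
    (P.OrdGE 1 (algebraMap (RatFunc k) K a) ↔ R.OrdGE 1 (algebraMap (RatFunc k) K a)) := by
  by_cases ha : a = 0
  · simp [ha, OrdGE]
  · obtain ⟨n, hn⟩ := exists_ord_algebraMap (K := K) q ha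
    have h1 : algebraMap (RatFunc k) K a ≠ 0 := by simpa using ha
    simp only [OrdGE, h1, false_or, hn P h, hn R hR]
    have e1 := h.ord_pos
    have e2 := hR.ord_pos
    refine ⟨by rw [mul_nonneg_iff_of_pos_left e1, mul_nonneg_iff_of_pos_left e2], ?_⟩
    rw [Order.one_le_iff_pos, Order.one_le_iff_pos, mul_pos_iff_of_pos_left e1,
      mul_pos_iff_of_pos_left e2]

lemma pointFunction_below [Algebra.IsAlgebraic (RatFunc k) K] (h : P.LiesOver q) :
    pointFunction (P.below (RatFunc k)) = algebraMap k[X] (RatFunc k) q := by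
  have hX : RatFunc.X ∈ (P.below (RatFunc k)).ring := by
    change algebraMap (RatFunc k) K RatFunc.X ∈ P.ring
    rw [← RatFunc.algebraMap_X]
    exact h.X_mem
  have hX' : polyMap (RatFunc k) (X : k[X]) ∈ (P.below (RatFunc k)).ring := by
    rw [polyMap_apply, RatFunc.algebraMap_X]
    exact hX
  have hq : (P.below (RatFunc k)).LiesOver q := by
    refine ⟨h.monic, h.irreducible, hX', ?_⟩
    by_contra hcon
    have h0 := polyMap_ne_zero (K := RatFunc k) h.irreducible.ne_zero
    simp only [OrdGE, h0, false_or] at hcon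
    -- If `q` did not vanish below, its inverse would be integral at `P`, against its positive
    -- valuation there.
    have h1 : (polyMap (RatFunc k) q)⁻¹ ∈ (P.below (RatFunc k)).ring := by
      rw [mem_ring_iff_ord, ord_inv]
      omega
    change algebraMap (RatFunc k) K _ ∈ P.ring at h1
    rw [map_inv₀, mem_ring_iff_ord, ord_inv] at h1
    have := h.ord_pos
    rw [polyMap_apply] at this
    change 0 ≤ - P.ord (algebraMap (RatFunc k) K (algebraMap k[X] (RatFunc k) q)) at h1
    omega
  rw [pointFunction, dif_pos hX, ← hq.minpoly_residue]
  congr!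

end LiesOver

/-- As `x` has a pole, the leading term of `g` has strictly smaller valuation than all the others.
-/
lemma ord_polyMap_of_X_notMem {P : Point k K} (hX : polyMap K (X : k[X]) ∉ P.ring) {g : k[X]}
    (hg : g ≠ 0) : P.ord (polyMap K g) = g.natDegree * P.ord (polyMap K (X : k[X])) := by
  have hx : P.ord (polyMap K (X : k[X])) < 0 := by
    rw [mem_ring_iff_ord] at hX
    omega
  have hX0 : polyMap K (X : k[X]) ≠ 0 := polyMap_ne_zero X_ne_zero
  have hlead : polyMap K (C g.leadingCoeff * X ^ g.natDegree) ≠ 0 :=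
    polyMap_ne_zero (by simpa using hg)
  have hord : P.ord (polyMap K (C g.leadingCoeff * X ^ g.natDegree)) =
      g.natDegree * P.ord (polyMap K (X : k[X])) := by
    rw [map_mul] at hlead ⊢
    rw [P.ord_mul (left_ne_zero_of_mul hlead) (right_ne_zero_of_mul hlead), polyMap_C,
      ord_algebraMap, map_pow, ord_pow, zero_add]
  have hrest : P.OrdGE (g.natDegree * P.ord (polyMap K (X : k[X])) + 1)
      (polyMap K g.eraseLead) := by
    rw [g.eraseLead.as_sum_range_C_mul_X_pow, map_sum]
    refine OrdGE.sum _ _ fun i hi => ?_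
    by_cases hc : g.eraseLead.coeff i = 0
    · rw [hc]; exact Or.inl (by simp)
    · have hlt : i < g.natDegree := by
        by_contra hle
        have h1 : i ≠ g.natDegree := by
          rintro rfl
          simp at hc
        rw [eraseLead_coeff_of_ne _ h1] at hc
        exact hc (coeff_eq_zero_of_natDegree_lt (by omega))
      refine Or.inr ?_
      rw [map_mul, polyMap_C, map_pow, P.ord_mul (by simpa using hc) (pow_ne_zero _ hX0),
        ord_algebraMap, ord_pow]
      have : (i : ℤ) + 1 ≤ g.natDegree := by exact_mod_cast hlt
      nlinarith
  rw [← hord] at hrest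
  have h := (P.ord_add_eq_of_lt hlead hrest).2
  rw [← map_add, add_comm, ← self_sub_C_mul_X_pow, sub_add_cancel, hord] at h
  exact h

end Point

end FunctionFieldCurve

/-! ### Conjugation and ramified points -/

namespace FunctionFieldCurve

universe u v

variable {k : Type u} [Field k] {K : Type v} [Field K] [Algebra (RatFunc k) K] [Algebra k K]

namespace Point

/-- Every residue class at `P` is represented by a rational function in `k(x)`. -/
def IsResiduallyRational (P : Point k K) : Prop :=
  ∀ w ∈ P.ring, ∃ a : RatFunc k, algebraMap (RatFunc k) K a ∈ P.ring ∧
    P.OrdGE 1 (w - algebraMap (RatFunc k) K a)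

end Point

open Point

namespace IsDoubleCover

variable {f : k[X]} {y : K} {σ : K ≃ₐ[k] K} {P R : Point k K} {q : k[X]}

lemma two_ne_zero' (h : IsDoubleCover f y σ) : (2 : K) ≠ 0 := by
  have : algebraMap k K 2 ≠ 0 := by simpa only [ne_eq, map_eq_zero] using h.two_ne_zero
  rwa [map_ofNat] at this

lemma two_mul_ord_y (h : IsDoubleCover f y σ) (P : Point k K) :
    2 * P.ord y = P.ord (polyMap K f) := by
  rw [polyMap_apply, ← h.sq_eq, ord_pow]
  norm_num

lemma conj_add (h : IsDoubleCover f y σ) (a b : RatFunc k) :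
    σ (algebraMap (RatFunc k) K a + algebraMap (RatFunc k) K b * y) =
      algebraMap (RatFunc k) K a - algebraMap (RatFunc k) K b * y := by
  rw [map_add, map_mul, h.conj_algebraMap, h.conj_algebraMap, h.conj_y]
  ring

lemma conj_point_conj (h : IsDoubleCover f y σ) (P : Point k K) : (P.conj σ).conj σ = P := by
  ext a
  rw [mem_conj_ring, mem_conj_ring, h.conj_conj]

lemma liesOver_conj (h : IsDoubleCover f y σ) (hP : P.LiesOver q) : (P.conj σ).LiesOver q := by
  refine ⟨hP.monic, hP.irreducible, ?_, ?_⟩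
  · rw [mem_conj_ring, polyMap_apply, h.conj_algebraMap]
    exact hP.X_mem
  · right
    rw [ord_conj, polyMap_apply, h.conj_algebraMap]
    exact hP.ord_pos

/-! ### Points at which the valuation of `y` is not that of a rational function -/

/-- The hypothesis keeps the valuations of `a` and `b y` apart, so no cancellation can occur. It
holds at ramified finite points (`ord_ne_of_dvd`) and at infinity (`ord_ne_of_X_notMem`). -/
lemma ordGE_add_mul_iff_of_ord_ne (h : IsDoubleCover f y σ)
    (hy : ∀ a : RatFunc k, a ≠ 0 → P.ord (algebraMap (RatFunc k) K a) ≠ P.ord y)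
    (n : ℤ) (a b : RatFunc k) :
    P.OrdGE n (algebraMap (RatFunc k) K a + algebraMap (RatFunc k) K b * y) ↔
      P.OrdGE n (algebraMap (RatFunc k) K a) ∧ P.OrdGE n (algebraMap (RatFunc k) K b * y) := by
  refine ⟨fun hab => ?_, fun hab => hab.1.add hab.2⟩
  by_cases ha : a = 0
  · subst ha
    rw [map_zero] at hab ⊢
    rw [zero_add] at hab
    exact ⟨P.ordGE_zero n, hab⟩
  by_cases hb : b = 0
  · subst hb
    rw [map_zero, zero_mul] at hab ⊢
    rw [add_zero] at hab
    exact ⟨hab, P.ordGE_zero n⟩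
  have ha' : algebraMap (RatFunc k) K a ≠ 0 := by simpa using ha
  have hb' : algebraMap (RatFunc k) K b ≠ 0 := by simpa using hb
  have hby := mul_ne_zero hb' h.y_ne_zero
  have hne : P.ord (algebraMap (RatFunc k) K a) ≠ P.ord (algebraMap (RatFunc k) K b * y) := by
    have := hy (a / b) (div_ne_zero ha hb)
    rw [map_div₀, P.ord_div ha' hb'] at this
    rw [P.ord_mul hb' h.y_ne_zero]
    omega
  rcases lt_or_gt_of_ne hne with hlt | hlt
  · obtain ⟨h0, he⟩ := P.ord_add_eq_of_lt ha' (b := algebraMap (RatFunc k) K b * y)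
      (Or.inr hlt)
    have := hab.resolve_left h0
    exact ⟨Or.inr (by omega), Or.inr (by omega)⟩
  · obtain ⟨h0, he⟩ := P.ord_add_eq_of_lt hby (b := algebraMap (RatFunc k) K a)
      (Or.inr hlt)
    rw [add_comm] at h0 he
    have := hab.resolve_left h0
    exact ⟨Or.inr (by omega), Or.inr (by omega)⟩

lemma conj_eq_of_ord_ne (h : IsDoubleCover f y σ)
    (hy : ∀ a : RatFunc k, a ≠ 0 → P.ord (algebraMap (RatFunc k) K a) ≠ P.ord y) :
    P.conj σ = P := by
  ext w
  obtain ⟨a, b, rfl⟩ := h.exists_eq w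
  rw [mem_conj_ring, mem_ring_iff, mem_ring_iff, h.conj_add, sub_eq_add_neg, ← neg_mul,
    ← map_neg, h.ordGE_add_mul_iff_of_ord_ne hy, h.ordGE_add_mul_iff_of_ord_ne hy, map_neg,
    neg_mul]
  refine and_congr_right fun _ => ⟨fun h => ?_, OrdGE.neg⟩
  simpa using h.neg

/-- For integral `a + b y` the term `b y` is integral too and its valuation is not zero, so it
vanishes at `P` and `a` represents the residue. -/
lemma isResiduallyRational_of_ord_ne (h : IsDoubleCover f y σ)
    (hy : ∀ a : RatFunc k, a ≠ 0 → P.ord (algebraMap (RatFunc k) K a) ≠ P.ord y) :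
    P.IsResiduallyRational := by
  intro w hw
  obtain ⟨a, b, rfl⟩ := h.exists_eq w
  rw [mem_ring_iff, h.ordGE_add_mul_iff_of_ord_ne hy] at hw
  refine ⟨a, (P.mem_ring_iff _).2 hw.1, ?_⟩
  rw [add_sub_cancel_left]
  by_cases hb : b = 0
  · exact Or.inl (by simp [hb])
  refine hw.2.imp id fun h0 => ?_
  have hb' : algebraMap (RatFunc k) K b ≠ 0 := by simpa using hb
  have := hy b⁻¹ (inv_ne_zero hb)
  rw [map_inv₀, ord_inv] at this
  rw [P.ord_mul hb' h.y_ne_zero] at h0 ⊢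
  omega

/-! ### Ramified finite points -/

lemma two_mul_ord_y_of_dvd [IsScalarTower k (RatFunc k) K] (h : IsDoubleCover f y σ)
    (hP : P.LiesOver q) (hq : q ∣ f) : 2 * P.ord y = P.ord (polyMap K q) := by
  have h1 : multiplicity q f = 1 := by
    refine multiplicity_eq_of_dvd_of_not_dvd (by simpa using hq) ?_
    exact h.not_sq_dvd q hP.irreducible
  rw [h.two_mul_ord_y, hP.ord_polyMap h.poly_ne_zero, h1]
  simp

/-- Valuations of rational functions are multiples of `2 * P.ord y`, and `P.ord y` is positive. -/
lemma ord_ne_of_dvd [IsScalarTower k (RatFunc k) K] (h : IsDoubleCover f y σ)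
    (hP : P.LiesOver q) (hq : q ∣ f) (a : RatFunc k) :
    P.ord (algebraMap (RatFunc k) K a) ≠ P.ord y := by
  intro he
  have h1 := h.two_mul_ord_y_of_dvd hP hq
  have h2 := hP.ord_pos
  have h3 := hP.ord_dvd a
  rw [he] at h3
  have := Int.le_of_dvd (by omega) h3
  omega

/-- Both parts of a uniformizer `a + b y` vanish at `P` and have valuations divisible by `P.ord y`,
so `P.ord y` is at most `1`. -/
lemma ord_y_eq_one_of_dvd [IsScalarTower k (RatFunc k) K] (h : IsDoubleCover f y σ)
    (hP : P.LiesOver q) (hq : q ∣ f) : P.ord y = 1 := by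
  have h1 := h.two_mul_ord_y_of_dvd hP hq
  have h2 := hP.ord_pos
  have hdvd : ∀ a : RatFunc k, P.ord y ∣ P.ord (algebraMap (RatFunc k) K a) := fun a =>
    (Dvd.intro_left 2 h1).trans (hP.ord_dvd a)
  have hstep : ∀ w : K, P.ord y ∣ P.ord w → P.OrdGE 1 w → P.OrdGE (P.ord y) w :=
    fun w hw h => h.imp id fun h => Int.le_of_dvd (by omega) hw
  obtain ⟨t, ht0, ht⟩ := P.exists_ord_eq_one
  obtain ⟨a, b, rfl⟩ := h.exists_eq t
  have h3 : P.OrdGE 1 (algebraMap (RatFunc k) K a + algebraMap (RatFunc k) K b * y) :=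
    Or.inr ht.ge
  rw [h.ordGE_add_mul_iff_of_ord_ne (fun a _ => h.ord_ne_of_dvd hP hq a)] at h3
  have h4 := hstep _ (hdvd a) h3.1
  have h5 : P.OrdGE (P.ord y) (algebraMap (RatFunc k) K b * y) := by
    refine hstep _ ?_ h3.2
    by_cases hb : b = 0
    · simp [hb, ord_zero]
    · rw [P.ord_mul (by simpa using hb) h.y_ne_zero]
      exact dvd_add (hdvd b) dvd_rfl
  have h6 := (h4.add h5).resolve_left ht0
  omega

lemma eq_of_dvd [IsScalarTower k (RatFunc k) K] (h : IsDoubleCover f y σ)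
    (hP : P.LiesOver q) (hR : R.LiesOver q) (hq : q ∣ f) : P = R := by
  have key : ∀ a : RatFunc k, P.ord (algebraMap (RatFunc k) K a) =
      R.ord (algebraMap (RatFunc k) K a) := by
    intro a
    by_cases ha : a = 0
    · simp [ha, ord_zero]
    obtain ⟨n, hn⟩ := LiesOver.exists_ord_algebraMap (K := K) q ha
    rw [hn P hP, hn R hR, ← h.two_mul_ord_y_of_dvd hP hq, ← h.two_mul_ord_y_of_dvd hR hq,
      h.ord_y_eq_one_of_dvd hP hq, h.ord_y_eq_one_of_dvd hR hq]
  ext w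
  obtain ⟨a, b, rfl⟩ := h.exists_eq w
  rw [mem_ring_iff, mem_ring_iff,
    h.ordGE_add_mul_iff_of_ord_ne (fun a _ => h.ord_ne_of_dvd hP hq a),
    h.ordGE_add_mul_iff_of_ord_ne (fun a _ => h.ord_ne_of_dvd hR hq a)]
  simp only [OrdGE, key a]
  by_cases hb : b = 0
  · simp [hb]
  · rw [P.ord_mul (by simpa using hb) h.y_ne_zero, R.ord_mul (by simpa using hb) h.y_ne_zero,
      key b, h.ord_y_eq_one_of_dvd hP hq, h.ord_y_eq_one_of_dvd hR hq]

end IsDoubleCover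

end FunctionFieldCurve

/-! ### Fibres over unramified polynomials -/

namespace FunctionFieldCurve

universe u v

variable {k : Type u} [Field k] {K : Type v} [Field K] [Algebra (RatFunc k) K] [Algebra k K]

open Point

namespace IsDoubleCover

variable {f : k[X]} {y : K} {σ : K ≃ₐ[k] K} {P R : Point k K} {q : k[X]}

/-! ### Unramified finite points -/

/-- Up to a factor in `k(x)`, every element is `a + y` with `a` integral at `P`, or `1 + b y` with
`b` in the maximal ideal. -/
lemma exists_normal_form (h : IsDoubleCover f y σ) (P : Point k K) {w : K} (hw : w ≠ 0) :
    ∃ c : RatFunc k, c ≠ 0 ∧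
      ((∃ a : RatFunc k, P.OrdGE 0 (algebraMap (RatFunc k) K a) ∧
          w = algebraMap (RatFunc k) K c * (algebraMap (RatFunc k) K a + y)) ∨
        ∃ b : RatFunc k, P.OrdGE 1 (algebraMap (RatFunc k) K b) ∧
          w = algebraMap (RatFunc k) K c * (1 + algebraMap (RatFunc k) K b * y)) := by
  obtain ⟨a, b, rfl⟩ := h.exists_eq w
  by_cases hb : b = 0
  · subst hb
    refine ⟨a, ?_, Or.inr ⟨0, Or.inl (by simp), by simp⟩⟩
    rintro rfl
    simp at hw
  have hb' : algebraMap (RatFunc k) K b ≠ 0 := by simpa using hb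
  by_cases hab : P.OrdGE 0 (algebraMap (RatFunc k) K (a / b))
  · refine ⟨b, hb, Or.inl ⟨a / b, hab, ?_⟩⟩
    rw [map_div₀]
    field_simp
  · simp only [OrdGE, not_or] at hab
    have ha : a ≠ 0 := by
      rintro rfl
      simp at hab
    have ha' : algebraMap (RatFunc k) K a ≠ 0 := by simpa using ha
    refine ⟨a, ha, Or.inr ⟨b / a, Or.inr ?_, ?_⟩⟩
    · have := hab.2
      rw [map_div₀, P.ord_div ha' hb'] at this
      rw [map_div₀, P.ord_div hb' ha']
      omega
    · rw [map_div₀]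
      field_simp

lemma mul_conj_add_y (h : IsDoubleCover f y σ) (a : RatFunc k) :
    (algebraMap (RatFunc k) K a + y) * (algebraMap (RatFunc k) K a - y) =
      algebraMap (RatFunc k) K (a ^ 2 - algebraMap k[X] (RatFunc k) f) := by
  rw [map_sub, map_pow, ← h.sq_eq]
  ring

variable [IsScalarTower k (RatFunc k) K]

lemma ord_y_eq_zero_of_not_dvd (h : IsDoubleCover f y σ) (hP : P.LiesOver q) (hq : ¬ q ∣ f) :
    P.ord y = 0 := by
  have := h.two_mul_ord_y P
  rw [hP.ord_of_not_dvd hq] at this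
  omega

lemma ordGE_zero_y (h : IsDoubleCover f y σ) (hP : P.LiesOver q) (hq : ¬ q ∣ f) :
    P.OrdGE 0 y := Or.inr (h.ord_y_eq_zero_of_not_dvd hP hq).ge

lemma ordGE_one_mul_y (h : IsDoubleCover f y σ) (hP : P.LiesOver q) (hq : ¬ q ∣ f)
    {b : K} (hb : P.OrdGE 1 b) : P.OrdGE 1 (b * y) :=
  hb.mul (h.ordGE_zero_y hP hq)

lemma ord_one_add (h : IsDoubleCover f y σ) (hP : P.LiesOver q) (hq : ¬ q ∣ f)
    {b : K} (hb : P.OrdGE 1 b) : 1 + b * y ≠ 0 ∧ P.ord (1 + b * y) = 0 := by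
  have := P.ord_add_eq_of_lt one_ne_zero (b := b * y)
    (by rw [ord_one]; exact h.ordGE_one_mul_y hP hq hb)
  rwa [ord_one] at this

/-- Of `a + y` and its conjugate, at most one vanishes at an unramified point. -/
lemma ord_conj_eq_zero (h : IsDoubleCover f y σ) (hP : P.LiesOver q) (hq : ¬ q ∣ f)
    {a : K} (ha : P.OrdGE 0 a) (hay : P.OrdGE 1 (a + y)) : a - y ≠ 0 ∧ P.ord (a - y) = 0 := by
  refine OrdGE.ord_eq_zero (ha.sub (h.ordGE_zero_y hP hq)) fun h1 => ?_
  have h2 : P.OrdGE 1 (2 * y) := by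
    have := hay.sub h1
    rwa [show a + y - (a - y) = 2 * y by ring] at this
  refine not_ordGE_one_of_ord_eq_zero (mul_ne_zero h.two_ne_zero' h.y_ne_zero) ?_ h2
  rw [P.ord_mul h.two_ne_zero' h.y_ne_zero, P.ord_two, h.ord_y_eq_zero_of_not_dvd hP hq, add_zero]

lemma ord_add_y (h : IsDoubleCover f y σ) (hP : P.LiesOver q) (hq : ¬ q ∣ f)
    {a : RatFunc k} (ha : P.OrdGE 0 (algebraMap (RatFunc k) K a))
    (ha0 : algebraMap (RatFunc k) K a + y ≠ 0)
    (hay : P.OrdGE 1 (algebraMap (RatFunc k) K a + y)) :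
    P.ord (algebraMap (RatFunc k) K a + y) =
      P.ord (algebraMap (RatFunc k) K (a ^ 2 - algebraMap k[X] (RatFunc k) f)) := by
  obtain ⟨h1, h2⟩ := h.ord_conj_eq_zero hP hq ha hay
  rw [← h.mul_conj_add_y, P.ord_mul ha0 h1, h2, add_zero]

/-- In either normal form the valuation equals that of a rational function, hence is a multiple of
the ramification index; apply this to a uniformizer. -/
lemma ord_poly_eq_one_of_not_dvd (h : IsDoubleCover f y σ) (hP : P.LiesOver q) (hq : ¬ q ∣ f) :
    P.ord (polyMap K q) = 1 := by
  obtain ⟨t, ht0, ht⟩ := P.exists_ord_eq_one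
  refine Int.eq_one_of_dvd_one hP.ord_pos.le ?_
  rw [← ht]
  obtain ⟨c, hc, ⟨a, ha, rfl⟩ | ⟨b, hb, rfl⟩⟩ := h.exists_normal_form P ht0
  · rw [P.ord_mul (left_ne_zero_of_mul ht0) (right_ne_zero_of_mul ht0)]
    refine dvd_add (hP.ord_dvd c) ?_
    by_cases hay : P.OrdGE 1 (algebraMap (RatFunc k) K a + y)
    · rw [h.ord_add_y hP hq ha (right_ne_zero_of_mul ht0) hay]
      exact hP.ord_dvd _
    · rw [((ha.add (h.ordGE_zero_y hP hq)).ord_eq_zero hay).2]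
      exact dvd_zero _
  · rw [P.ord_mul (left_ne_zero_of_mul ht0) (right_ne_zero_of_mul ht0),
      (h.ord_one_add hP hq hb).2, add_zero]
    exact hP.ord_dvd c

lemma ord_algebraMap_eq_of_not_dvd (h : IsDoubleCover f y σ) (hP : P.LiesOver q)
    (hR : R.LiesOver q) (hq : ¬ q ∣ f) (a : RatFunc k) :
    P.ord (algebraMap (RatFunc k) K a) = R.ord (algebraMap (RatFunc k) K a) := by
  by_cases ha : a = 0
  · simp [ha, ord_zero]
  obtain ⟨n, hn⟩ := LiesOver.exists_ord_algebraMap (K := K) q ha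
  rw [hn P hP, hn R hR, h.ord_poly_eq_one_of_not_dvd hP hq, h.ord_poly_eq_one_of_not_dvd hR hq]

/-- Two unramified points over `q` agree when the same elements `a + y` vanish at them. -/
lemma eq_of_ordGE_one_iff (h : IsDoubleCover f y σ) (hP : P.LiesOver q) (hR : R.LiesOver q)
    (hq : ¬ q ∣ f)
    (hc : ∀ a : RatFunc k, P.OrdGE 0 (algebraMap (RatFunc k) K a) →
      (P.OrdGE 1 (algebraMap (RatFunc k) K a + y) ↔ R.OrdGE 1 (algebraMap (RatFunc k) K a + y))) :
    P = R := by
  refine ext_ord fun w hw => ?_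
  suffices P.ord w = R.ord w by rw [this]
  obtain ⟨c, hc0, ⟨a, ha, rfl⟩ | ⟨b, hb, rfl⟩⟩ := h.exists_normal_form P hw
  · have haR := ((hP.ordGE_algebraMap_iff hR a).1).1 ha
    have h0 := right_ne_zero_of_mul hw
    rw [P.ord_mul (left_ne_zero_of_mul hw) h0, R.ord_mul (left_ne_zero_of_mul hw) h0,
      h.ord_algebraMap_eq_of_not_dvd hP hR hq]
    congr 1
    by_cases hay : P.OrdGE 1 (algebraMap (RatFunc k) K a + y)
    · rw [h.ord_add_y hP hq ha h0 hay, h.ord_add_y hR hq haR h0 ((hc a ha).1 hay),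
        h.ord_algebraMap_eq_of_not_dvd hP hR hq]
    · rw [((ha.add (h.ordGE_zero_y hP hq)).ord_eq_zero hay).2,
        ((haR.add (h.ordGE_zero_y hR hq)).ord_eq_zero (fun h' => hay ((hc a ha).2 h'))).2]
  · have hbR := ((hP.ordGE_algebraMap_iff hR b).2).1 hb
    have h0 := right_ne_zero_of_mul hw
    rw [P.ord_mul (left_ne_zero_of_mul hw) h0, R.ord_mul (left_ne_zero_of_mul hw) h0,
      h.ord_algebraMap_eq_of_not_dvd hP hR hq, (h.ord_one_add hP hq hb).2,
      (h.ord_one_add hR hq hbR).2]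

/-- Where `y` has the value `c`, the vanishing of `a + y` is that of `a + c`, which depends only on
the point below. -/
lemma eq_of_common_value (h : IsDoubleCover f y σ) (hP : P.LiesOver q) (hR : R.LiesOver q)
    (hq : ¬ q ∣ f) {c : RatFunc k}
    (hPc : P.OrdGE 1 (y - algebraMap (RatFunc k) K c))
    (hRc : R.OrdGE 1 (y - algebraMap (RatFunc k) K c)) : P = R := by
  refine h.eq_of_ordGE_one_iff hP hR hq fun a _ => ?_
  have key : ∀ S : Point k K, S.OrdGE 1 (y - algebraMap (RatFunc k) K c) →
      (S.OrdGE 1 (algebraMap (RatFunc k) K a + y) ↔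
        S.OrdGE 1 (algebraMap (RatFunc k) K (a + c))) := by
    intro S hS
    have e : algebraMap (RatFunc k) K a + y =
        algebraMap (RatFunc k) K (a + c) + (y - algebraMap (RatFunc k) K c) := by
      rw [map_add]; ring
    rw [e]
    refine ⟨fun h1 => ?_, fun h1 => h1.add hS⟩
    have := h1.sub hS
    rwa [add_sub_cancel_right] at this
  rw [key P hPc, key R hRc]
  exact (hP.ordGE_algebraMap_iff hR _).2

/-- The rational function `c² - f` vanishes at `P`, hence at `R`; so `c - y` or `c + y` vanishes at
`R`, which singles out `P` or its conjugate. -/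
lemma eq_or_eq_conj_of_value (h : IsDoubleCover f y σ) (hP : P.LiesOver q) (hR : R.LiesOver q)
    (hq : ¬ q ∣ f) {c : RatFunc k} (hc0 : P.OrdGE 0 (algebraMap (RatFunc k) K c))
    (hPc : P.OrdGE 1 (y - algebraMap (RatFunc k) K c)) : R = P ∨ R = P.conj σ := by
  have h1 : P.OrdGE 1 (algebraMap (RatFunc k) K (c ^ 2 - algebraMap k[X] (RatFunc k) f)) := by
    rw [← h.mul_conj_add_y]
    have := (hc0.add (h.ordGE_zero_y hP hq)).mul hPc.neg
    simpa using this
  have hc0' := ((hP.ordGE_algebraMap_iff hR c).1).1 hc0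
  rw [(hP.ordGE_algebraMap_iff hR _).2, ← h.mul_conj_add_y] at h1
  by_cases h2 : R.OrdGE 1 (algebraMap (RatFunc k) K c - y)
  · left
    exact h.eq_of_common_value hR hP hq (by simpa using h2.neg) hPc
  · right
    have h3 : R.OrdGE 1 (algebraMap (RatFunc k) K c + y) := by
      obtain ⟨h4, h5⟩ := (hc0'.sub (h.ordGE_zero_y hR hq)).ord_eq_zero h2
      refine h1.imp (fun h0 => (mul_eq_zero.1 h0).resolve_right h4) fun h6 => ?_
      by_cases h7 : algebraMap (RatFunc k) K c + y = 0
      · rw [h7, zero_mul, ord_zero] at h6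
        omega
      · rwa [R.ord_mul h7 h4, h5, add_zero] at h6
    have h4 : (P.conj σ).OrdGE 1 (y - algebraMap (RatFunc k) K (-c)) := by
      refine hPc.neg.imp (fun h0 => ?_) fun h0 => ?_
      · have := congrArg σ h0
        simp only [map_neg, map_sub, h.conj_algebraMap, h.conj_y, map_zero] at this
        rw [map_neg]
        linear_combination this
      · rw [ord_conj]
        simpa [h.conj_algebraMap, h.conj_y, add_comm, sub_eq_add_neg] using h0
    refine h.eq_of_common_value hR (h.liesOver_conj hP) hq ?_ h4
    rw [map_neg]
    simpa [add_comm] using h3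

/-- The points over `q` form one orbit under conjugation. -/
lemma eq_or_eq_conj (h : IsDoubleCover f y σ) (hP : P.LiesOver q) (hR : R.LiesOver q) :
    R = P ∨ R = P.conj σ := by
  by_cases hq : q ∣ f
  · exact Or.inl (h.eq_of_dvd hR hP hq)
  by_cases hc : ∃ a : RatFunc k, P.OrdGE 0 (algebraMap (RatFunc k) K a) ∧
      P.OrdGE 1 (algebraMap (RatFunc k) K a + y)
  · obtain ⟨a, ha, hay⟩ := hc
    refine h.eq_or_eq_conj_of_value hP hR hq (c := -a) ?_ ?_
    · rw [map_neg]; exact ha.neg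
    · rw [map_neg]; simpa [add_comm] using hay
  by_cases hd : ∃ a : RatFunc k, R.OrdGE 0 (algebraMap (RatFunc k) K a) ∧
      R.OrdGE 1 (algebraMap (RatFunc k) K a + y)
  · obtain ⟨a, ha, hay⟩ := hd
    have := h.eq_or_eq_conj_of_value hR hP hq (c := -a) (by rw [map_neg]; exact ha.neg)
      (by rw [map_neg]; simpa [add_comm] using hay)
    rcases this with h1 | h1
    · exact Or.inl h1.symm
    · exact Or.inr (by rw [h1, h.conj_point_conj])
  -- No `a + y` with `a` integral vanishes at either point, so the criterion `eq_of_ordGE_one_iff`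
  -- holds vacuously.
  · push Not at hc hd
    refine Or.inl (h.eq_of_ordGE_one_iff hP hR hq fun a ha => ?_).symm
    exact iff_of_false (hc a ha) (hd a (((hP.ordGE_algebraMap_iff hR a).1).1 ha))

/-- If `P` is unramified and not fixed by conjugation, then `y` has a value in `k(x)` at `P`. -/
lemma exists_value_of_conj_ne (h : IsDoubleCover f y σ) (hP : P.LiesOver q) (hq : ¬ q ∣ f)
    (hne : P.conj σ ≠ P) : ∃ c : RatFunc k, P.OrdGE 0 (algebraMap (RatFunc k) K c) ∧
      P.OrdGE 1 (y - algebraMap (RatFunc k) K c) := by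
  by_contra! hcon
  have hcon' : ∀ a : RatFunc k, P.OrdGE 0 (algebraMap (RatFunc k) K a) →
      ¬ P.OrdGE 1 (algebraMap (RatFunc k) K a + y) := fun a ha h1 =>
    hcon (-a) (by rw [map_neg]; exact ha.neg) (by rw [map_neg]; simpa [add_comm] using h1)
  refine hne (h.eq_of_ordGE_one_iff hP (h.liesOver_conj hP) hq fun a ha => ?_).symm
  refine iff_of_false (hcon' a ha) fun h1 => hcon a ha ?_
  refine h1.neg.imp (fun h0 => ?_) fun h0 => ?_
  · have := congrArg σ h0
    simp only [map_neg, map_add, h.conj_algebraMap, h.conj_y, map_zero] at this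
    linear_combination this
  · rw [ord_conj] at h0
    simpa [h.conj_algebraMap, h.conj_y, add_comm, sub_eq_add_neg] using h0

/-- If `P` is unramified and fixed by conjugation, then `y` has no value in `k(x)` at `P`. -/
lemma not_ordGE_one_add_y_of_conj_eq (h : IsDoubleCover f y σ) (hP : P.LiesOver q)
    (hq : ¬ q ∣ f) (he : P.conj σ = P) {a : RatFunc k}
    (ha : P.OrdGE 0 (algebraMap (RatFunc k) K a)) :
    ¬ P.OrdGE 1 (algebraMap (RatFunc k) K a + y) := by
  intro h1
  obtain ⟨h2, h3⟩ := h.ord_conj_eq_zero hP hq ha h1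
  have h4 : σ (algebraMap (RatFunc k) K a + y) = algebraMap (RatFunc k) K a - y := by
    rw [map_add, h.conj_algebraMap, h.conj_y, sub_eq_add_neg]
  rw [← h4, ← ord_conj, he] at h3
  rcases h1 with h1 | h1
  · rw [← h4, h1, map_zero] at h2
    exact h2 rfl
  · omega

lemma isResiduallyRational_of_conj_ne (h : IsDoubleCover f y σ) (hP : P.LiesOver q)
    (hq : ¬ q ∣ f) (hne : P.conj σ ≠ P) : P.IsResiduallyRational := by
  obtain ⟨c, hc0, hc⟩ := h.exists_value_of_conj_ne hP hq hne
  intro w hw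
  by_cases hw0 : w = 0
  · exact ⟨0, by simp [P.ring.zero_mem], by simp [hw0, OrdGE]⟩
  rw [mem_ring_iff] at hw
  have hw' := hw.resolve_left hw0
  obtain ⟨d, hd0, ⟨a, ha, rfl⟩ | ⟨b, hb, rfl⟩⟩ := h.exists_normal_form P hw0
  · have h0 := right_ne_zero_of_mul hw0
    have hd0' := left_ne_zero_of_mul hw0
    by_cases hay : P.OrdGE 1 (algebraMap (RatFunc k) K a + y)
    · obtain ⟨h1, h2⟩ := h.ord_conj_eq_zero hP hq ha hay
      have h3 : algebraMap (RatFunc k) K a - algebraMap (RatFunc k) K c ≠ 0 ∧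
          P.ord (algebraMap (RatFunc k) K a - algebraMap (RatFunc k) K c) = 0 := by
        have := P.ord_add_eq_of_lt h1 (b := y - algebraMap (RatFunc k) K c)
          (by rw [h2]; exact hc)
        rwa [sub_add_sub_cancel, h2] at this
      have hu : P.OrdGE 0 (algebraMap (RatFunc k) K
          (d * (a ^ 2 - algebraMap k[X] (RatFunc k) f))) := by
        rw [map_mul, ← h.mul_conj_add_y, ← mul_assoc]
        have := hw.mul (n := 0) (Or.inr h2.ge)
        simpa using this
      have hinv : P.OrdGE 0 ((algebraMap (RatFunc k) K a - algebraMap (RatFunc k) K c)⁻¹) :=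
        Or.inr (by rw [ord_inv, h3.2]; simp)
      have hinv' : P.OrdGE 0 ((algebraMap (RatFunc k) K a - y)⁻¹) :=
        Or.inr (by rw [ord_inv, h2]; simp)
      -- Here `d` may have a pole compensated by the zero of `a + y`, so `y` cannot simply be
      -- replaced by `c`. Instead `d (a + y) = d (a² - f) / (a - y)`, where the numerator is
      -- integral and the denominator is a unit congruent to `a - c`.
      refine ⟨d * (a ^ 2 - algebraMap k[X] (RatFunc k) f) / (a - c), ?_, ?_⟩
      · rw [mem_ring_iff, map_div₀, div_eq_mul_inv, map_sub]
        simpa using hu.mul hinv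
      · have e : algebraMap (RatFunc k) K d * (algebraMap (RatFunc k) K a + y) -
            algebraMap (RatFunc k) K
              (d * (a ^ 2 - algebraMap k[X] (RatFunc k) f) / (a - c)) =
            algebraMap (RatFunc k) K (d * (a ^ 2 - algebraMap k[X] (RatFunc k) f)) *
              (y - algebraMap (RatFunc k) K c) *
              ((algebraMap (RatFunc k) K a - y)⁻¹ *
                (algebraMap (RatFunc k) K a - algebraMap (RatFunc k) K c)⁻¹) := by
          rw [map_div₀, map_mul, ← h.mul_conj_add_y, map_sub]
          have h3' := h3.1
          field_simp
          ring
        rw [e]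
        have := (hu.mul hc).mul (hinv'.mul hinv)
        simpa using this
    · have h1 := ((ha.add (h.ordGE_zero_y hP hq)).ord_eq_zero hay).2
      rw [P.ord_mul hd0' h0, h1, add_zero] at hw'
      have hd : P.OrdGE 0 (algebraMap (RatFunc k) K d) := Or.inr hw'
      refine ⟨d * (a + c), ?_, ?_⟩
      · rw [mem_ring_iff, map_mul, map_add]
        simpa using hd.mul (ha.add hc0)
      · rw [map_mul, map_add, ← mul_sub, add_sub_add_left_eq_sub]
        simpa using hd.mul hc
  · rw [P.ord_mul (left_ne_zero_of_mul hw0) (right_ne_zero_of_mul hw0),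
      (h.ord_one_add hP hq hb).2, add_zero] at hw'
    have hd : P.OrdGE 0 (algebraMap (RatFunc k) K d) := Or.inr hw'
    refine ⟨d, (P.mem_ring_iff _).2 hd, ?_⟩
    rw [mul_add, mul_one, add_sub_cancel_left]
    simpa using hd.mul (h.ordGE_one_mul_y hP hq hb)

/-- At an unramified point fixed by conjugation, the integral elements are spanned by `1` and
`y`. -/
lemma exists_integral_coordinates (h : IsDoubleCover f y σ) (hP : P.LiesOver q)
    (hq : ¬ q ∣ f) (he : P.conj σ = P) {w : K} (hw : w ∈ P.ring) :
    ∃ a b : RatFunc k, algebraMap (RatFunc k) K a ∈ P.ring ∧ algebraMap (RatFunc k) K b ∈ P.ring ∧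
      w = algebraMap (RatFunc k) K a + algebraMap (RatFunc k) K b * y := by
  by_cases hw0 : w = 0
  · exact ⟨0, 0, by simp [P.ring.zero_mem], by simp [P.ring.zero_mem], by simp [hw0]⟩
  have hw' := (P.mem_ring_iff_ord _).1 hw
  obtain ⟨d, hd0, ⟨a, ha, rfl⟩ | ⟨b, hb, rfl⟩⟩ := h.exists_normal_form P hw0
  · rw [P.ord_mul (left_ne_zero_of_mul hw0) (right_ne_zero_of_mul hw0),
      ((ha.add (h.ordGE_zero_y hP hq)).ord_eq_zero
        (h.not_ordGE_one_add_y_of_conj_eq hP hq he ha)).2, add_zero, ← mem_ring_iff_ord] at hw'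
    refine ⟨d * a, d, ?_, hw', by rw [map_mul]; ring⟩
    rw [map_mul]
    exact P.ring.mul_mem _ _ hw' ((P.mem_ring_iff _).2 ha)
  · rw [P.ord_mul (left_ne_zero_of_mul hw0) (right_ne_zero_of_mul hw0),
      (h.ord_one_add hP hq hb).2, add_zero, ← mem_ring_iff_ord] at hw'
    refine ⟨d, d * b, hw', ?_, by rw [map_mul]; ring⟩
    rw [map_mul]
    exact P.ring.mul_mem _ _ hw' ((P.mem_ring_iff _).2 (hb.mono zero_le_one))

end IsDoubleCover

end FunctionFieldCurve

/-! ### Residue fields, inertia degrees and the point at infinity -/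

namespace FunctionFieldCurve

universe u v

variable {k : Type u} [Field k] {K : Type v} [Field K] [Algebra (RatFunc k) K] [Algebra k K]

namespace Point

variable {P : Point k K} {q : k[X]}

lemma IsResiduallyRational.inertiaDegree_eq_one (h : P.IsResiduallyRational) :
    P.inertiaDegree (RatFunc k) = 1 := by
  unfold inertiaDegree
  let _ := (IsLocalRing.ResidueField.map (comapHom (RatFunc k) P.ring)).toAlgebra
  refine finrank_eq_one (1 : IsLocalRing.ResidueField P.ring) one_ne_zero fun r => ?_
  obtain ⟨w, hw, rfl⟩ := P.residue_surjective r
  obtain ⟨a, ha, haw⟩ := h w hw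
  refine ⟨IsLocalRing.residue _ ⟨a, ha⟩, ?_⟩
  rw [Algebra.smul_def, mul_one]
  change IsLocalRing.residue P.ring (comapHom (RatFunc k) P.ring ⟨a, ha⟩) = _
  rw [residue_eq_iff, ← neg_sub]
  exact haw.neg

variable [IsScalarTower k (RatFunc k) K]

/-- In lowest terms the denominator is prime to `q`, for otherwise `a` would have a pole; so the
residue is a quotient of polynomials in the residue of `x`. -/
lemma LiesOver.residue_algebraMap_mem_adjoin (hP : P.LiesOver q) (a : RatFunc k)
    (ha : algebraMap (RatFunc k) K a ∈ P.ring) :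
    IsLocalRing.residue P.ring ⟨_, ha⟩ ∈
      IntermediateField.adjoin k {IsLocalRing.residue P.ring ⟨_, hP.X_mem⟩} := by
  have hden : ¬ q ∣ a.denom := by
    intro hd
    have hn : ¬ q ∣ a.num := fun hn =>
      hP.irreducible.not_isUnit (a.isCoprime_num_denom.isUnit_of_dvd' hn hd)
    have hn0 : a.num ≠ 0 := by rintro h; simp [h] at hn
    have h1 := hP.ord_of_not_dvd hn
    have h2 := (hP.ordGE_one_iff_dvd _).2 hd
    have h3 := h2.resolve_left (polyMap_ne_zero a.denom_ne_zero)
    rw [mem_ring_iff_ord, ← RatFunc.num_div_denom a, map_div₀, ← polyMap_apply, ← polyMap_apply,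
      P.ord_div (polyMap_ne_zero hn0) (polyMap_ne_zero a.denom_ne_zero)] at ha
    omega
  have hmul : IsLocalRing.residue P.ring ⟨_, ha⟩ *
      aeval (IsLocalRing.residue P.ring ⟨_, hP.X_mem⟩) a.denom =
        aeval (IsLocalRing.residue P.ring ⟨_, hP.X_mem⟩) a.num := by
    rw [← residue_polyMap, ← residue_polyMap, ← map_mul]
    congr 1
    apply Subtype.ext
    change algebraMap (RatFunc k) K a * polyMap K a.denom = polyMap K a.num
    rw [polyMap_apply, polyMap_apply, ← map_mul]
    congr 1
    nth_rewrite 1 [← RatFunc.num_div_denom a]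
    exact div_mul_cancel₀ _ (by simp [a.denom_ne_zero])
  have hne : aeval (IsLocalRing.residue P.ring ⟨_, hP.X_mem⟩) a.denom ≠ 0 := by
    rw [Ne, aeval_residue_eq_zero_iff, hP.ordGE_one_iff_dvd]
    exact hden
  rw [eq_div_of_mul_eq hne hmul]
  have hmem : ∀ g : k[X], aeval (IsLocalRing.residue P.ring ⟨_, hP.X_mem⟩) g ∈
      IntermediateField.adjoin k {IsLocalRing.residue P.ring ⟨_, hP.X_mem⟩} := fun g =>
    IntermediateField.algebra_adjoin_le_adjoin _ _ (aeval_mem_adjoin_singleton _ _)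
  exact div_mem (hmem _) (hmem _)

lemma LiesOver.degree_eq (hP : P.LiesOver q) (h : P.IsResiduallyRational) :
    P.degree = q.natDegree := by
  have hint : IsIntegral k (IsLocalRing.residue P.ring ⟨_, hP.X_mem⟩) :=
    ⟨q, hP.monic, (aeval_residue_eq_zero_iff hP.X_mem q).2 hP.ordGE_one⟩
  have htop : IntermediateField.adjoin k {IsLocalRing.residue P.ring ⟨_, hP.X_mem⟩} = ⊤ := by
    refine eq_top_iff.2 fun r _ => ?_
    obtain ⟨w, hw, rfl⟩ := P.residue_surjective r
    obtain ⟨a, ha, haw⟩ := h w hw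
    rw [(P.residue_eq_iff ⟨w, hw⟩ ⟨_, ha⟩).2 haw]
    exact hP.residue_algebraMap_mem_adjoin a ha
  rw [degree, ← hP.minpoly_residue, ← IntermediateField.adjoin.finrank hint, htop,
    IntermediateField.finrank_top']

lemma exists_ord_eq_mul_of_X_notMem (hX : polyMap K (X : k[X]) ∉ P.ring) {a : RatFunc k}
    (ha : a ≠ 0) : ∃ n : ℤ, P.ord (algebraMap (RatFunc k) K a) =
      n * P.ord (polyMap K (X : k[X])) := by
  obtain ⟨g₁, g₂, h1, h2, e⟩ := exists_algebraMap_eq_div (K := K) ha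
  refine ⟨(g₁.natDegree : ℤ) - g₂.natDegree, ?_⟩
  rw [e, P.ord_div (polyMap_ne_zero h1) (polyMap_ne_zero h2), ord_polyMap_of_X_notMem hX h1,
    ord_polyMap_of_X_notMem hX h2]
  ring

lemma exists_const_of_X_notMem (hX : polyMap K (X : k[X]) ∉ P.ring) (a : RatFunc k)
    (ha : algebraMap (RatFunc k) K a ∈ P.ring) :
    ∃ c : k, P.OrdGE 1 (algebraMap (RatFunc k) K a - algebraMap k K c) := by
  by_cases ha0 : a = 0
  · exact ⟨0, by simp [ha0, OrdGE]⟩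
  have hx : P.ord (polyMap K (X : k[X])) < 0 := by
    rw [mem_ring_iff_ord] at hX
    omega
  obtain ⟨g₁, g₂, h1, h2, e⟩ := exists_algebraMap_eq_div (K := K) ha0
  have hdeg : g₁.natDegree ≤ g₂.natDegree := by
    rw [mem_ring_iff_ord, e, P.ord_div (polyMap_ne_zero h1) (polyMap_ne_zero h2),
      ord_polyMap_of_X_notMem hX h1, ord_polyMap_of_X_notMem hX h2, ← sub_mul] at ha
    by_contra! hlt
    have : (0 : ℤ) < (g₁.natDegree : ℤ) - g₂.natDegree := by
      have : (g₂.natDegree : ℤ) < g₁.natDegree := by exact_mod_cast hlt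
      omega
    nlinarith
  -- The value at infinity: the quotient of the leading coefficients if the degrees agree, and `0`
  -- if `g₁` has smaller degree.
  refine ⟨g₁.coeff g₂.natDegree / g₂.leadingCoeff, ?_⟩
  set c := g₁.coeff g₂.natDegree / g₂.leadingCoeff with hc
  have e2 : algebraMap (RatFunc k) K a - algebraMap k K c =
      polyMap K (g₁ - C c * g₂) / polyMap K g₂ := by
    have := polyMap_ne_zero (K := K) h2
    rw [e, map_sub, map_mul, polyMap_C]
    field_simp
  rw [e2]
  by_cases hg : g₁ - C c * g₂ = 0
  · exact Or.inl (by simp [hg])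
  have hlt : (g₁ - C c * g₂).natDegree < g₂.natDegree := by
    have hle : (g₁ - C c * g₂).natDegree ≤ g₂.natDegree :=
      (natDegree_sub_le _ _).trans (max_le hdeg (natDegree_C_mul_le _ _))
    refine lt_of_le_of_ne hle fun heq => hg ?_
    rw [← leadingCoeff_eq_zero, leadingCoeff, heq, coeff_sub, coeff_C_mul, coeff_natDegree, hc,
      div_mul_cancel₀ _ (leadingCoeff_ne_zero.2 h2), sub_self]
  refine Or.inr ?_
  rw [P.ord_div (polyMap_ne_zero hg) (polyMap_ne_zero h2), ord_polyMap_of_X_notMem hX hg,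
    ord_polyMap_of_X_notMem hX h2, ← sub_mul]
  have : ((g₁ - C c * g₂).natDegree : ℤ) + 1 ≤ g₂.natDegree := by exact_mod_cast hlt
  nlinarith

lemma degree_eq_one_of_X_notMem (hX : polyMap K (X : k[X]) ∉ P.ring)
    (h : P.IsResiduallyRational) : P.degree = 1 := by
  refine finrank_eq_one (1 : P.residueField) one_ne_zero fun r => ?_
  obtain ⟨w, hw, rfl⟩ := P.residue_surjective r
  obtain ⟨a, ha, haw⟩ := h w hw
  obtain ⟨c, hc⟩ := exists_const_of_X_notMem hX a ha
  refine ⟨c, ?_⟩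
  rw [Algebra.smul_def, mul_one]
  change IsLocalRing.residue P.ring (algebraMap k P.ring c) = _
  rw [residue_eq_iff]
  have := (haw.add hc).neg
  rwa [sub_add_sub_cancel, neg_sub] at this

end Point

open Point

namespace IsDoubleCover

variable {f : k[X]} {y : K} {σ : K ≃ₐ[k] K} {P : Point k K} {q : k[X]}
  [IsScalarTower k (RatFunc k) K]

/-- The residues of `1` and `y` form a basis. They span by `exists_integral_coordinates`; a relation
in which `b` is a unit would make `a / b + y` vanish at a point fixed by conjugation. -/
lemma inertiaDegree_eq_two (h : IsDoubleCover f y σ) (hP : P.LiesOver q) (hq : ¬ q ∣ f)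
    (he : P.conj σ = P) : P.inertiaDegree (RatFunc k) = 2 := by
  unfold inertiaDegree
  let _ := (IsLocalRing.ResidueField.map (comapHom (RatFunc k) P.ring)).toAlgebra
  have hymem : y ∈ P.ring := (P.mem_ring_iff _).2 (h.ordGE_zero_y hP hq)
  have hsmul : ∀ (a : RatFunc k) (ha : a ∈ P.ring.comap (algebraMap (RatFunc k) K))
      (w : P.ring), IsLocalRing.residue (P.ring.comap (algebraMap (RatFunc k) K)) ⟨a, ha⟩ •
        IsLocalRing.residue P.ring w = IsLocalRing.residue P.ring (⟨_, ha⟩ * w) := fun a ha w => by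
    rw [Algebra.smul_def, map_mul]
    rfl
  have hli : LinearIndependent (IsLocalRing.ResidueField (P.ring.comap (algebraMap (RatFunc k) K)))
      ![(1 : IsLocalRing.ResidueField P.ring), IsLocalRing.residue P.ring ⟨y, hymem⟩] := by
    rw [LinearIndependent.pair_iff]
    intro s t hst
    obtain ⟨⟨a, ha⟩, rfl⟩ := IsLocalRing.residue_surjective s
    obtain ⟨⟨b, hb⟩, rfl⟩ := IsLocalRing.residue_surjective t
    rw [← map_one (IsLocalRing.residue P.ring), hsmul, hsmul, ← map_add,
      IsLocalRing.residue_eq_zero_iff, mem_maximalIdeal_iff] at hst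
    replace hst : P.OrdGE 1 (algebraMap (RatFunc k) K a + algebraMap (RatFunc k) K b * y) := by
      simpa using hst
    have ha0 := (P.mem_ring_iff _).1 (show algebraMap (RatFunc k) K a ∈ P.ring from ha)
    have hb0 := (P.mem_ring_iff _).1 (show algebraMap (RatFunc k) K b ∈ P.ring from hb)
    have hb1 : P.OrdGE 1 (algebraMap (RatFunc k) K b) := by
      by_contra hcon
      obtain ⟨h1, h2⟩ := hb0.ord_eq_zero hcon
      have hinv : P.OrdGE 0 ((algebraMap (RatFunc k) K b)⁻¹) :=
        Or.inr (by rw [ord_inv, h2]; simp)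
      refine h.not_ordGE_one_add_y_of_conj_eq hP hq he (a := a / b) ?_ ?_
      · rw [map_div₀, div_eq_mul_inv]
        simpa using ha0.mul hinv
      · have := hst.mul hinv
        rw [add_mul, mul_right_comm, mul_inv_cancel₀ h1, one_mul, ← div_eq_mul_inv,
          ← map_div₀] at this
        simpa using this
    have ha1 : P.OrdGE 1 (algebraMap (RatFunc k) K a) := by
      have := hst.sub (h.ordGE_one_mul_y hP hq hb1)
      rwa [add_sub_cancel_right] at this
    have key : ∀ (c : RatFunc k) (hc : c ∈ P.ring.comap (algebraMap (RatFunc k) K)),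
        P.OrdGE 1 (algebraMap (RatFunc k) K c) →
          IsLocalRing.residue (P.ring.comap (algebraMap (RatFunc k) K)) ⟨c, hc⟩ = 0 := by
      intro c hc hc1
      apply (IsLocalRing.ResidueField.map (comapHom (RatFunc k) P.ring)).injective
      rw [map_zero]
      change IsLocalRing.residue P.ring ⟨_, hc⟩ = 0
      rw [IsLocalRing.residue_eq_zero_iff, mem_maximalIdeal_iff]
      exact hc1
    exact ⟨key a ha ha1, key b hb hb1⟩
  have hsp : ⊤ ≤ Submodule.span
      (IsLocalRing.ResidueField (P.ring.comap (algebraMap (RatFunc k) K)))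
      (Set.range ![(1 : IsLocalRing.ResidueField P.ring),
        IsLocalRing.residue P.ring ⟨y, hymem⟩]) := by
    intro r _
    obtain ⟨w, hw, rfl⟩ := P.residue_surjective r
    obtain ⟨a, b, ha, hb, rfl⟩ := h.exists_integral_coordinates hP hq he hw
    rw [Matrix.range_cons, Matrix.range_cons, Matrix.range_empty, Set.union_empty,
      Set.singleton_union, Submodule.mem_span_pair]
    have ha' : a ∈ P.ring.comap (algebraMap (RatFunc k) K) := ha
    have hb' : b ∈ P.ring.comap (algebraMap (RatFunc k) K) := hb
    refine ⟨IsLocalRing.residue _ ⟨a, ha'⟩, IsLocalRing.residue _ ⟨b, hb'⟩, ?_⟩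
    rw [← map_one (IsLocalRing.residue P.ring), hsmul, hsmul, ← map_add]
    congr 1
    apply Subtype.ext
    change algebraMap (RatFunc k) K a * 1 + algebraMap (RatFunc k) K b * y = _
    rw [mul_one]
  rw [Module.finrank_eq_card_basis (Module.Basis.mk hli hsp), Fintype.card_fin]

/-- Equality would give `deg f = 2 n`, because `2 ord y = deg f · ord x` and `ord a = n · ord x`. -/
lemma ord_ne_of_X_notMem (h : IsDoubleCover f y σ) (hX : polyMap K (X : k[X]) ∉ P.ring)
    (a : RatFunc k) (ha : a ≠ 0) : P.ord (algebraMap (RatFunc k) K a) ≠ P.ord y := by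
  intro he
  obtain ⟨n, hn⟩ := exists_ord_eq_mul_of_X_notMem hX ha
  have h1 := h.two_mul_ord_y P
  rw [ord_polyMap_of_X_notMem hX h.poly_ne_zero, ← he, hn, ← mul_assoc] at h1
  have hx : P.ord (polyMap K (X : k[X])) ≠ 0 := by
    rw [mem_ring_iff_ord] at hX
    omega
  have h2 := mul_right_cancel₀ hx h1
  obtain ⟨m, hm⟩ := h.odd_natDegree
  rw [hm] at h2
  push_cast at h2
  omega

/-- Infinity is ramified, so a point there has residue field `k` and degree one, which is odd. -/
lemma X_mem_of_even_degree (h : IsDoubleCover f y σ) (hP : Even P.degree) :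
    polyMap K (X : k[X]) ∈ P.ring := by
  by_contra hX
  rw [degree_eq_one_of_X_notMem hX (h.isResiduallyRational_of_ord_ne (h.ord_ne_of_X_notMem hX))]
    at hP
  exact Nat.not_even_one hP

/-- A finite point is ramified, split or inert. -/
lemma ramified_or_split_or_inert (h : IsDoubleCover f y σ) (hP : P.LiesOver q) :
    (P.IsResiduallyRational ∧ P.conj σ = P ∧ P.ord (polyMap K q) = 2) ∨
    (P.IsResiduallyRational ∧ P.conj σ ≠ P ∧ P.ord (polyMap K q) = 1) ∨
    (P.inertiaDegree (RatFunc k) = 2 ∧ P.conj σ = P ∧ P.ord (polyMap K q) = 1) := by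
  by_cases hq : q ∣ f
  · left
    have hne := fun (a : RatFunc k) (_ : a ≠ 0) => h.ord_ne_of_dvd hP hq a
    refine ⟨h.isResiduallyRational_of_ord_ne hne, h.conj_eq_of_ord_ne hne, ?_⟩
    rw [← h.two_mul_ord_y_of_dvd hP hq, h.ord_y_eq_one_of_dvd hP hq, mul_one]
  · right
    by_cases he : P.conj σ = P
    · exact Or.inr ⟨h.inertiaDegree_eq_two hP hq he, he, h.ord_poly_eq_one_of_not_dvd hP hq⟩
    · exact Or.inl ⟨h.isResiduallyRational_of_conj_ne hP hq he, he,
        h.ord_poly_eq_one_of_not_dvd hP hq⟩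

lemma divisorNormFunction_single [Algebra.IsAlgebraic (RatFunc k) K] (hP : P.LiesOver q) :
    divisorNormFunction (Finsupp.single P 1) =
      algebraMap k[X] (RatFunc k) q ^ P.inertiaDegree (RatFunc k) := by
  unfold divisorNormFunction divisorNorm divisorFunction
  rw [Finsupp.liftAddHom_apply_single]
  simp [Finsupp.prod_single_index, hP.pointFunction_below]

end IsDoubleCover

end FunctionFieldCurve

/-! ### Existence of points and finiteness of divisors -/

namespace FunctionFieldCurve

universe u v

lemma isDiscreteValuationRing_valuationSubringAtPrime {R : Type u} {K : Type v} [CommRing R]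
    [IsDedekindDomain R] [Field K] [Algebra R K] [IsFractionRing R K]
    (v : IsDedekindDomain.HeightOneSpectrum R) : IsDiscreteValuationRing
      (IsDedekindDomain.HeightOneSpectrum.valuationSubringAtPrime K v) :=
  have : IsLocalization.AtPrime
    (IsDedekindDomain.HeightOneSpectrum.valuationSubringAtPrime K v) v.asIdeal :=
    inferInstanceAs (IsLocalization v.asIdeal.primeCompl _)
  IsLocalization.AtPrime.isDiscreteValuationRing_of_dedekind_domain R (P := v.asIdeal) v.ne_bot _

variable {k : Type u} [Field k] {K : Type v} [Field K] [Algebra (RatFunc k) K] [Algebra k K]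

open Point

namespace IsDoubleCover

variable {f : k[X]} {y : K} {σ : K ≃ₐ[k] K} {P R : Point k K} {q : k[X]}

/-- Used to make the integral closure of `k[x]` in `K` a Dedekind domain with fraction field `K`. -/
lemma isSeparable (h : IsDoubleCover f y σ) : Algebra.IsSeparable (RatFunc k) K := by
  have h2 : ((2 : ℕ) : RatFunc k) ≠ 0 := by
    have : (RatFunc.C (2 : k)) ≠ 0 := by simpa only [ne_eq, map_eq_zero] using h.two_ne_zero
    rwa [map_ofNat] at this
  have hy : IsSeparable (RatFunc k) y :=
    (separable_X_pow_sub_C (n := 2) (algebraMap k[X] (RatFunc k) f) h2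
      (by simpa using h.poly_ne_zero)).of_dvd
        (minpoly.dvd _ _ (by simp [h.sq_eq]))
  refine ⟨fun w => ?_⟩
  obtain ⟨a, b, rfl⟩ := h.exists_eq w
  exact Field.isSeparable_add (isSeparable_algebraMap a)
    (Field.isSeparable_mul (isSeparable_algebraMap b) hy)

/-- The link between the divisor of `w` and its norm on which both implications rest. -/
lemma ord_add_ord_conj (h : IsDoubleCover f y σ) (P : Point k K) {w : K} (hw : w ≠ 0) :
    P.ord w + (P.conj σ).ord w =
      P.ord (algebraMap (RatFunc k) K (Algebra.norm (RatFunc k) w)) := by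
  rw [h.algebraMap_norm, P.ord_mul hw (by simpa using hw), ord_conj]

lemma algebraMap_trace (h : IsDoubleCover f y σ) (w : K) :
    ∃ t : RatFunc k, algebraMap (RatFunc k) K t = w + σ w := by
  obtain ⟨a, b, rfl⟩ := h.exists_eq w
  refine ⟨2 * a, ?_⟩
  rw [h.conj_add, map_mul, map_ofNat]
  ring

lemma norm_ne_zero (h : IsDoubleCover f y σ) {w : K} (hw : w ≠ 0) :
    Algebra.norm (RatFunc k) w ≠ 0 := by
  intro h0
  have := h.algebraMap_norm w
  rw [h0, map_zero, eq_comm, mul_eq_zero] at this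
  simp [hw] at this

variable [IsScalarTower k (RatFunc k) K]

/-- There is a point over every monic irreducible polynomial. -/
lemma exists_liesOver [FiniteDimensional (RatFunc k) K] (h : IsDoubleCover f y σ)
    (hq : q.Monic) (hirr : Irreducible q) : ∃ P : Point k K, P.LiesOver q := by
  let _ : Algebra k[X] K := (polyMap K).toAlgebra
  have : IsScalarTower k[X] (RatFunc k) K := IsScalarTower.of_algebraMap_eq fun _ => rfl
  have := h.isSeparable
  have hded : IsDedekindDomain (integralClosure k[X] K) :=
    integralClosure.isDedekindDomain k[X] (RatFunc k) K
  have hfrac : IsFractionRing (integralClosure k[X] K) K :=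
    integralClosure.isFractionRing_of_finite_extension (RatFunc k) K
  have hinj : Function.Injective (algebraMap k[X] (integralClosure k[X] K)) := by
    refine (injective_iff_map_eq_zero _).2 fun c hc => ?_
    by_contra hc0
    exact polyMap_ne_zero hc0 (congrArg Subtype.val hc)
  have hmax : (Ideal.span {q}).IsMaximal := PrincipalIdealRing.isMaximal_of_irreducible hirr
  -- The point is the localization of the integral closure of `k[x]` at a maximal ideal over `(q)`.
  obtain ⟨M, hM, hMq⟩ := Ideal.exists_ideal_over_maximal_of_isIntegral
    (S := integralClosure k[X] K) (Ideal.span {q})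
    (by rw [(RingHom.injective_iff_ker_eq_bot _).1 hinj]; exact bot_le)
  have hqM : algebraMap k[X] (integralClosure k[X] K) q ∈ M := by
    rw [← Ideal.mem_comap, hMq]
    exact Ideal.mem_span_singleton_self q
  have hq0 : algebraMap k[X] (integralClosure k[X] K) q ≠ 0 := by
    rw [Ne, map_eq_zero_iff _ hinj]
    exact hirr.ne_zero
  have hM0 : M ≠ ⊥ := by
    rintro rfl
    exact hq0 hqM
  let v : IsDedekindDomain.HeightOneSpectrum (integralClosure k[X] K) := ⟨M, hM.isPrime, hM0⟩
  have hmem : ∀ g : k[X], polyMap K g ∈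
      IsDedekindDomain.HeightOneSpectrum.valuationSubringAtPrime K v := fun g => by
    rw [v.valuationSubringAtPrime_eq_valuationSubring, Valuation.mem_valuationSubring_iff]
    exact v.valuation_le_one (algebraMap k[X] (integralClosure k[X] K) g)
  let P : Point k K :=
    { ring := IsDedekindDomain.HeightOneSpectrum.valuationSubringAtPrime K v
      const_mem := fun c => polyMap_C (K := K) c ▸ hmem (C c)
      isDVR := isDiscreteValuationRing_valuationSubringAtPrime v }
  refine ⟨P, hq, hirr, hmem X, ?_⟩
  have hlt : v.valuation K (polyMap K q) < 1 :=
    (v.valuation_lt_one_iff_mem (K := K) (algebraMap k[X] (integralClosure k[X] K) q)).2 hqM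
  right
  by_contra hcon
  have hinv : (polyMap K q)⁻¹ ∈ P.ring := by
    rw [mem_ring_iff_ord, ord_inv]
    omega
  change _ ∈ IsDedekindDomain.HeightOneSpectrum.valuationSubringAtPrime K v at hinv
  rw [v.valuationSubringAtPrime_eq_valuationSubring, Valuation.mem_valuationSubring_iff,
    map_inv₀, inv_le_one₀ (by
      rw [zero_lt_iff, Valuation.ne_zero_iff]; exact polyMap_ne_zero hirr.ne_zero)] at hinv
  exact absurd hlt (not_lt.2 hinv)

/-! ### Finiteness of the support of a principal divisor -/

lemma eq_of_X_notMem (h : IsDoubleCover f y σ) (hP : polyMap K (X : k[X]) ∉ P.ring)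
    (hR : polyMap K (X : k[X]) ∉ R.ring) : P = R := by
  have hx : P.ord (polyMap K (X : k[X])) < 0 := by rw [mem_ring_iff_ord] at hP; omega
  have hx' : R.ord (polyMap K (X : k[X])) < 0 := by rw [mem_ring_iff_ord] at hR; omega
  -- Integrality of `z` amounts to `m ≤ 0` at both points, `ord x` being negative. Doubling
  -- accommodates `y`, for which `m = deg f`.
  have hcong : ∀ (m : ℤ) (z : K), 2 * P.ord z = m * P.ord (polyMap K (X : k[X])) →
      2 * R.ord z = m * R.ord (polyMap K (X : k[X])) → (P.OrdGE 0 z ↔ R.OrdGE 0 z) := by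
    intro m z h1 h2
    refine or_congr_right ⟨fun h3 => ?_, fun h3 => ?_⟩
    · have : m ≤ 0 := by nlinarith
      nlinarith
    · have : m ≤ 0 := by nlinarith
      nlinarith
  have hord : ∀ a : RatFunc k, a ≠ 0 → ∃ m : ℤ,
      P.ord (algebraMap (RatFunc k) K a) = m * P.ord (polyMap K (X : k[X])) ∧
      R.ord (algebraMap (RatFunc k) K a) = m * R.ord (polyMap K (X : k[X])) := by
    intro a ha
    obtain ⟨g₁, g₂, h1, h2, e⟩ := exists_algebraMap_eq_div (K := K) ha
    refine ⟨(g₁.natDegree : ℤ) - g₂.natDegree, ?_, ?_⟩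
    · rw [e, P.ord_div (polyMap_ne_zero h1) (polyMap_ne_zero h2), ord_polyMap_of_X_notMem hP h1,
        ord_polyMap_of_X_notMem hP h2]
      ring
    · rw [e, R.ord_div (polyMap_ne_zero h1) (polyMap_ne_zero h2), ord_polyMap_of_X_notMem hR h1,
        ord_polyMap_of_X_notMem hR h2]
      ring
  ext w
  obtain ⟨a, b, rfl⟩ := h.exists_eq w
  rw [mem_ring_iff, mem_ring_iff, h.ordGE_add_mul_iff_of_ord_ne (h.ord_ne_of_X_notMem hP),
    h.ordGE_add_mul_iff_of_ord_ne (h.ord_ne_of_X_notMem hR)]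
  refine and_congr ?_ ?_
  · by_cases ha : a = 0
    · simp [ha, OrdGE]
    obtain ⟨m, h1, h2⟩ := hord a ha
    exact hcong (2 * m) _ (by rw [h1]; ring) (by rw [h2]; ring)
  · by_cases hb : b = 0
    · simp [hb, OrdGE]
    obtain ⟨m, h1, h2⟩ := hord b hb
    have hb' : algebraMap (RatFunc k) K b ≠ 0 := by simpa using hb
    refine hcong (2 * m + f.natDegree) _ ?_ ?_
    · rw [P.ord_mul hb' h.y_ne_zero, mul_add, h.two_mul_ord_y, h1,
        ord_polyMap_of_X_notMem hP h.poly_ne_zero]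
      ring
    · rw [R.ord_mul hb' h.y_ne_zero, mul_add, h.two_mul_ord_y, h2,
        ord_polyMap_of_X_notMem hR h.poly_ne_zero]
      ring

lemma finite_setOf_liesOver (h : IsDoubleCover f y σ) (q : k[X]) :
    {P : Point k K | P.LiesOver q}.Finite := by
  by_cases hq : ∃ P : Point k K, P.LiesOver q
  · obtain ⟨P, hP⟩ := hq
    refine (Set.toFinite {P, P.conj σ}).subset fun R hR => ?_
    simpa using h.eq_or_eq_conj hP hR
  · push Not at hq
    convert Set.finite_empty
    ext P
    simpa using hq P

/-- Away from infinity and the factors of `G`, the trace of `w` is integral and its norm is a unit.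
Then `w` and `σ w` have opposite valuations, and if these were nonzero the trace would have a pole.
-/
lemma finite_setOf_ord_ne_zero [Algebra.IsAlgebraic (RatFunc k) K] (h : IsDoubleCover f y σ)
    {w : K} (hw : w ≠ 0) : {P : Point k K | P.ord w ≠ 0}.Finite := by
  classical
  obtain ⟨t, ht⟩ := h.algebraMap_trace w
  have hn0 := h.norm_ne_zero hw
  set n := Algebra.norm (RatFunc k) w with hn
  set G : k[X] := t.denom * n.num * n.denom with hG
  have hG0 : G ≠ 0 := mul_ne_zero (mul_ne_zero t.denom_ne_zero (RatFunc.num_ne_zero hn0))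
    n.denom_ne_zero
  have hfin : (⋃ q ∈ (UniqueFactorizationMonoid.normalizedFactors G).toFinset,
      {P : Point k K | P.LiesOver q}).Finite :=
    Set.Finite.biUnion (Finset.finite_toSet _) fun q _ => h.finite_setOf_liesOver q
  have hinf : {P : Point k K | polyMap K (X : k[X]) ∉ P.ring}.Finite :=
    Set.Subsingleton.finite fun P hP R hR => h.eq_of_X_notMem hP hR
  refine (hinf.union hfin).subset fun P hP => ?_
  by_cases hX : polyMap K (X : k[X]) ∈ P.ring
  swap
  · exact Or.inl hX
  right
  obtain ⟨q, hPq⟩ := Point.exists_liesOver hX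
  simp only [Set.mem_iUnion, exists_prop, Multiset.mem_toFinset]
  refine ⟨q, (Polynomial.mem_normalizedFactors_iff hG0).2 ⟨hPq.irreducible, hPq.monic, ?_⟩, hPq⟩
  by_contra hdvd
  apply hP
  have hd1 : ¬ q ∣ t.denom := fun hd => hdvd ((hd.mul_right _).mul_right _)
  have hd2 : ¬ q ∣ n.num := fun hd => hdvd ((hd.mul_left _).mul_right _)
  have hd3 : ¬ q ∣ n.denom := fun hd => hdvd (hd.mul_left _)
  have hnord : P.ord (algebraMap (RatFunc k) K n) = 0 := by
    rw [← RatFunc.num_div_denom n, map_div₀, ← polyMap_apply, ← polyMap_apply,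
      P.ord_div (polyMap_ne_zero (RatFunc.num_ne_zero hn0)) (polyMap_ne_zero n.denom_ne_zero),
      hPq.ord_of_not_dvd hd2, hPq.ord_of_not_dvd hd3, sub_zero]
  have htord : P.OrdGE 0 (w + σ w) := by
    rw [← ht, ← RatFunc.num_div_denom t, map_div₀, ← polyMap_apply, ← polyMap_apply,
      div_eq_mul_inv]
    have h1 := (P.mem_ring_iff _).1 (polyMap_mem hPq.X_mem t.num)
    have h2 : P.OrdGE 0 ((polyMap K t.denom)⁻¹) :=
      Or.inr (by rw [ord_inv, hPq.ord_of_not_dvd hd1]; simp)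
    simpa using h1.mul h2
  have hsum := h.ord_add_ord_conj P hw
  rw [← hn, hnord, ord_conj] at hsum
  have hσw : σ w ≠ 0 := by simpa using hw
  rcases lt_trichotomy (P.ord w) 0 with hlt | h0 | hlt
  · obtain ⟨h1, h2⟩ := P.ord_add_eq_of_lt hw (b := σ w) (Or.inr (by omega))
    have := htord.resolve_left h1
    omega
  · exact h0
  · obtain ⟨h1, h2⟩ := P.ord_add_eq_of_lt hσw (b := w) (Or.inr (by omega))
    rw [add_comm] at h1 h2
    have := htord.resolve_left h1
    omega

end IsDoubleCover

end FunctionFieldCurve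

/-! ### Squares of polynomials and parity of divisors -/

namespace FunctionFieldCurve

universe u v

section Polynomials

variable {k : Type u} [Field k]

lemma multiplicity_sq_mul {p q g : k[X]} (hp : Irreducible p) (hq : q ≠ 0) (hg : g ≠ 0) :
    multiplicity p (q ^ 2 * g) = 2 * multiplicity p q + multiplicity p g := by
  have hfin : ∀ a : k[X], a ≠ 0 → FiniteMultiplicity p a := fun a ha =>
    FiniteMultiplicity.of_not_isUnit hp.not_isUnit ha
  rw [multiplicity_mul hp.prime (hfin _ (mul_ne_zero (pow_ne_zero _ hq) hg)),
    (hfin q hq).multiplicity_pow hp.prime]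

/-- A polynomial in which all monic irreducible factors have even multiplicity is a constant times
a square. -/
lemma exists_eq_C_mul_sq (g : k[X]) (hg : g ≠ 0)
    (h : ∀ p : k[X], p.Monic → Irreducible p → Even (multiplicity p g)) :
    ∃ (c : k) (r : k[X]), c ≠ 0 ∧ r ≠ 0 ∧ g = C c * r ^ 2 := by
  induction hn : g.natDegree using Nat.strong_induction_on generalizing g with
  | _ n ih =>
    by_cases hu : IsUnit g
    · obtain ⟨c, hc, rfl⟩ := Polynomial.isUnit_iff.1 hu
      exact ⟨c, 1, hc.ne_zero, one_ne_zero, by simp⟩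
    obtain ⟨q, hqm, hqi, hqg⟩ := exists_monic_irreducible_factor g hu
    have hfin := FiniteMultiplicity.of_not_isUnit hqi.not_isUnit hg
    have h1 : 2 ≤ multiplicity q g := by
      obtain ⟨m, hm⟩ := h q hqm hqi
      have : multiplicity q g ≠ 0 := by
        rw [Ne, multiplicity_eq_zero]
        exact not_not.2 hqg
      omega
    obtain ⟨g', rfl⟩ := pow_dvd_of_le_multiplicity h1
    have hg' := right_ne_zero_of_mul hg
    have hdeg : g'.natDegree < n := by
      rw [← hn, natDegree_mul (pow_ne_zero _ hqi.ne_zero) hg', natDegree_pow]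
      have := hqi.natDegree_pos
      omega
    obtain ⟨c, r, hc, hr, e⟩ := ih _ hdeg g' hg' (fun p hpm hpi => by
      have := h p hpm hpi
      rw [multiplicity_sq_mul hpi hqi.ne_zero hg'] at this
      exact (Nat.even_add.1 this).1 (even_two_mul _)) rfl
    exact ⟨c, q * r, hc, mul_ne_zero hqi.ne_zero hr, by rw [e]; ring⟩

/-- For `b ≠ 0` the degree of `f b²` is odd and that of `a²` is even, so nothing cancels and an even
total degree means that `a²` dominates. -/
lemma isSquare_leadingCoeff_sq_sub {f a b : k[X]} (hf : Odd f.natDegree)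
    (hev : Even (a ^ 2 - f * b ^ 2).natDegree) :
    (a ^ 2 - f * b ^ 2).leadingCoeff = a.leadingCoeff ^ 2 := by
  by_cases hb : b = 0
  · simp [hb]
  have hf0 : f ≠ 0 := by rintro rfl; simp at hf
  have hd : (f * b ^ 2).natDegree = f.natDegree + 2 * b.natDegree := by
    rw [natDegree_mul hf0 (pow_ne_zero _ hb), natDegree_pow]
  have hodd : Odd (f * b ^ 2).natDegree := by
    rw [hd]; exact hf.add_even (even_two_mul _)
  rcases lt_trichotomy (f * b ^ 2).natDegree (a ^ 2).natDegree with hlt | heq | hlt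
  · rw [leadingCoeff_sub_of_degree_lt (degree_lt_degree hlt), leadingCoeff_pow]
  · rw [heq, natDegree_pow] at hodd
    exact absurd hodd (Nat.not_odd_iff_even.2 (even_two_mul _))
  · rw [natDegree_sub_eq_right_of_natDegree_lt hlt] at hev
    exact absurd hodd (Nat.not_odd_iff_even.2 hev)

/-- If `p (a² - f b²)` is a constant times a square, with `p` monic of even degree and `f` of odd
degree, then the constant is a square. -/
lemma isSquare_of_mul_eq_C_mul_sq {f p a b r v : k[X]} {c : k} (hf : Odd f.natDegree)
    (hp : p.Monic) (hev : Even p.natDegree) (hc : c ≠ 0) (hr : r ≠ 0)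
    (h : p * (a ^ 2 - f * b ^ 2) * v ^ 2 = C c * r ^ 2) : IsSquare c := by
  have h0 : p * (a ^ 2 - f * b ^ 2) * v ^ 2 ≠ 0 := by
    rw [h]
    exact mul_ne_zero (C_ne_zero.2 hc) (pow_ne_zero _ hr)
  have hv := right_ne_zero_of_mul h0
  have hg := right_ne_zero_of_mul (left_ne_zero_of_mul h0)
  have hdeg := congrArg natDegree h
  rw [natDegree_mul (left_ne_zero_of_mul h0) hv, natDegree_mul hp.ne_zero hg, natDegree_pow,
    natDegree_C_mul hc, natDegree_pow] at hdeg
  have hlc := congrArg leadingCoeff h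
  rw [leadingCoeff_mul, leadingCoeff_mul, leadingCoeff_mul, leadingCoeff_pow, leadingCoeff_pow,
    -- By `hdeg` the degree of `a² - f b²` is even, all other degrees there being even.
    leadingCoeff_C, hp.leadingCoeff, isSquare_leadingCoeff_sq_sub hf (by grind)] at hlc
  refine ⟨a.leadingCoeff * v.leadingCoeff / r.leadingCoeff, ?_⟩
  have := leadingCoeff_ne_zero.2 hr
  field_simp
  linear_combination -hlc

end Polynomials

variable {k : Type u} [Field k] {K : Type v} [Field K] [Algebra (RatFunc k) K] [Algebra k K]

open Point

namespace IsDoubleCover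

variable {f : k[X]} {y : K} {σ : K ≃ₐ[k] K} {P R : Point k K} {p q : k[X]}
lemma ne_of_X_notMem (hP : P.LiesOver p) (hX : polyMap K (X : k[X]) ∉ R.ring) : P ≠ R := by
  rintro rfl
  exact hX hP.X_mem

variable [IsScalarTower k (RatFunc k) K]

/-- The class of a point is divisible by two when the point is, modulo two, a principal divisor. -/
lemma exists_picClass_eq_two_smul_iff [Algebra.IsAlgebraic (RatFunc k) K]
    (h : IsDoubleCover f y σ) (P : Point k K) :
    (∃ c : Pic k K, P.picClass = 2 • c) ↔
      ∃ w : K, w ≠ 0 ∧ ∀ R : Point k K, Even (R.ord w + Finsupp.single P (1 : ℤ) R) := by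
  constructor
  · rintro ⟨c, hc⟩
    obtain ⟨D, rfl⟩ := QuotientAddGroup.mk_surjective c
    have h1 : -Finsupp.single P (1 : ℤ) + 2 • D ∈ principalDivisors k K :=
      QuotientAddGroup.eq.1 hc
    obtain ⟨w, hw, hD⟩ := h1
    refine ⟨w, hw, fun R => ⟨D R, ?_⟩⟩
    rw [← hD R, Finsupp.add_apply, Finsupp.neg_apply, Finsupp.smul_apply]
    ring
  · rintro ⟨w, hw, hev⟩
    -- The divisor whose class halves that of `P` is `(P - div w) / 2`; the parity hypothesis makes
    -- the integer division exact.
    have hfin : (Function.support fun R : Point k K =>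
        (Finsupp.single P (1 : ℤ) R - R.ord w) / 2).Finite := by
      refine ((h.finite_setOf_ord_ne_zero hw).union (Set.finite_singleton P)).subset
        fun R hR => ?_
      by_contra hcon
      simp only [Set.mem_union, Set.mem_ofPred_eq, Set.mem_singleton_iff, not_or, not_not] at hcon
      apply hR
      simp [hcon.1, hcon.2]
    refine ⟨QuotientAddGroup.mk (Finsupp.ofSupportFinite _ hfin), ?_⟩
    refine QuotientAddGroup.eq.2 ⟨w⁻¹, inv_ne_zero hw, fun R => ?_⟩
    rw [Finsupp.add_apply, Finsupp.neg_apply]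
    change -(Finsupp.single P (1 : ℤ) R) +
      2 • ((Finsupp.single P (1 : ℤ) R - R.ord w) / 2) = R.ord w⁻¹
    obtain ⟨m, hm⟩ := hev R
    rw [ord_inv, two_nsmul]
    omega

lemma even_ord_X_of_X_notMem (h : IsDoubleCover f y σ) (hX : polyMap K (X : k[X]) ∉ P.ring) :
    Even (P.ord (polyMap K (X : k[X]))) := by
  have h1 := h.two_mul_ord_y P
  rw [ord_polyMap_of_X_notMem hX h.poly_ne_zero] at h1
  have h2 : Even ((f.natDegree : ℤ) * P.ord (polyMap K (X : k[X]))) := ⟨P.ord y, by omega⟩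
  rcases Int.even_mul.1 h2 with h3 | h3
  · rw [Int.even_coe_nat] at h3
    exact absurd h.odd_natDegree (Nat.not_odd_iff_even.2 h3)
  · exact h3

lemma even_ord_polyMap_of_X_notMem (h : IsDoubleCover f y σ)
    (hX : polyMap K (X : k[X]) ∉ P.ring) (g : k[X]) : Even (P.ord (polyMap K g)) := by
  by_cases hg : g = 0
  · simp [hg, ord_zero]
  · rw [ord_polyMap_of_X_notMem hX hg]
    exact (h.even_ord_X_of_X_notMem hX).mul_left _

lemma ord_polyMap_irreducible [DecidableEq k[X]] (hR : R.LiesOver q) (hp : p.Monic)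
    (hpi : Irreducible p) :
    R.ord (polyMap K p) = if p = q then R.ord (polyMap K q) else 0 := by
  split_ifs with he
  · rw [he]
  · refine hR.ord_of_not_dvd fun hd => he ?_
    exact (eq_of_monic_of_associated hp hR.monic
      (hR.irreducible.associated_of_dvd hpi hd).symm)

lemma eq_iff_of_conj_eq (h : IsDoubleCover f y σ) (hP : P.LiesOver p) (hR : R.LiesOver q)
    (he : R.conj σ = R) : P = R ↔ p = q := by
  constructor
  · rintro rfl
    exact hR.eq hP
  · rintro rfl
    rcases h.eq_or_eq_conj hR hP with h1 | h1
    · exact h1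
    · rw [h1, he]

lemma single_add_single_conj [DecidableEq k[X]] (h : IsDoubleCover f y σ) (hP : P.LiesOver p)
    (hR : R.LiesOver q) (hne : R.conj σ ≠ R) :
    Finsupp.single P (1 : ℤ) R + Finsupp.single P (1 : ℤ) (R.conj σ) = if p = q then 1 else 0 := by
  classical
  rw [Finsupp.single_apply, Finsupp.single_apply]
  split_ifs with h1 h2 h3 h4 h5 h6 h7
  · exact absurd (h2.symm.trans h1) hne
  · exact absurd (h2.symm.trans h1) hne
  · rfl
  · exact absurd (hR.eq (h1 ▸ hP)) h4
  · rfl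
  · exact absurd ((h.liesOver_conj hR).eq (h5 ▸ hP)) h6
  · subst h7
    rcases h.eq_or_eq_conj hR hP with h8 | h8
    · exact absurd h8 h1
    · exact absurd h8 h5
  · rfl

/-- If the inertia degree is two, the point is `div p` up to twice a divisor. -/
lemma even_ord_polyMap_add_single_of_inert [Algebra.IsAlgebraic (RatFunc k) K]
    (h : IsDoubleCover f y σ) (hP : P.LiesOver p)
    (he : P.conj σ = P) (h1 : P.ord (polyMap K p) = 1) (R : Point k K) :
    Even (R.ord (polyMap K p) + Finsupp.single P (1 : ℤ) R) := by
  classical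
  by_cases hX : polyMap K (X : k[X]) ∈ R.ring
  · obtain ⟨q, hR⟩ := Point.exists_liesOver hX
    rw [ord_polyMap_irreducible hR hP.monic hP.irreducible, Finsupp.single_apply]
    have hiff : P = R ↔ p = q := by
      rw [eq_comm, h.eq_iff_of_conj_eq hR hP he, eq_comm]
    by_cases hpq : p = q
    · have := hiff.2 hpq
      subst this hpq
      simp [h1]
    · simp [hpq, mt hiff.1 hpq]
  · rw [Finsupp.single_eq_of_ne (ne_of_X_notMem hP hX).symm, add_zero]
    exact h.even_ord_polyMap_of_X_notMem hX p

end IsDoubleCover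

end FunctionFieldCurve

/-! ### The two implications for points of inertia degree one -/

namespace FunctionFieldCurve

universe u v

variable {k : Type u} [Field k] {K : Type v} [Field K] [Algebra (RatFunc k) K] [Algebra k K]

open Point

namespace IsDoubleCover

variable {f : k[X]} {y : K} {σ : K ≃ₐ[k] K} {P R : Point k K} {p q : k[X]}
variable [IsScalarTower k (RatFunc k) K]

/-! ### From divisibility of the class to a norm -/

lemma ord_algebraMap_eq_mul (hR : R.LiesOver q) {n : RatFunc k} (hn : n ≠ 0) :
    R.ord (algebraMap (RatFunc k) K n) =
      R.ord (polyMap K q) * ((multiplicity q n.num : ℤ) - multiplicity q n.denom) := by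
  conv_lhs => rw [← RatFunc.num_div_denom n]
  rw [map_div₀, ← polyMap_apply, ← polyMap_apply,
    R.ord_div (polyMap_ne_zero (RatFunc.num_ne_zero hn)) (polyMap_ne_zero n.denom_ne_zero),
    hR.ord_polyMap (RatFunc.num_ne_zero hn), hR.ord_polyMap n.denom_ne_zero]
  ring

/-- Modulo two this is the order of `p · N(w)` at `q`. For `R` over `q`, the order of `N(w)` at `q`
is `ord_R w` if `R` is ramified, the sum over both points if split, and `2 ord_R w` if inert. In the
inert case `p ≠ q`, as `P` has inertia degree one. -/
lemma even_multiplicity [FiniteDimensional (RatFunc k) K] (h : IsDoubleCover f y σ)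
    (hP : P.LiesOver p) (hdeg : P.inertiaDegree (RatFunc k) = 1) {w : K} (hw : w ≠ 0)
    (hev : ∀ R : Point k K, Even (R.ord w + Finsupp.single P (1 : ℤ) R))
    (hq : q.Monic) (hqi : Irreducible q) :
    Even (multiplicity q (p * (Algebra.norm (RatFunc k) w).num *
      (Algebra.norm (RatFunc k) w).denom)) := by
  classical
  obtain ⟨R, hR⟩ := h.exists_liesOver hq hqi
  have hn0 := h.norm_ne_zero hw
  have hsum := h.ord_add_ord_conj R hw
  rw [ord_algebraMap_eq_mul hR hn0] at hsum
  set n := Algebra.norm (RatFunc k) w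
  have hnum := RatFunc.num_ne_zero hn0
  have hp0 := hP.irreducible.ne_zero
  have hfin : ∀ a : k[X], a ≠ 0 → FiniteMultiplicity q a := fun a ha =>
    FiniteMultiplicity.of_not_isUnit hqi.not_isUnit ha
  rw [multiplicity_mul hqi.prime (hfin _ (mul_ne_zero (mul_ne_zero hp0 hnum) n.denom_ne_zero)),
    multiplicity_mul hqi.prime (hfin _ (mul_ne_zero hp0 hnum))]
  have hpq : (multiplicity q p : ℤ) = if p = q then 1 else 0 := by
    have h1 := hR.ord_polyMap hp0
    rw [ord_polyMap_irreducible hR hP.monic hP.irreducible] at h1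
    have h2 := hR.ord_pos.ne'
    split_ifs at h1 ⊢ with he
    · exact (mul_left_cancel₀ h2 (by rw [mul_one]; exact h1)).symm
    · exact (mul_eq_zero.1 h1.symm).resolve_left h2
  rw [← Int.even_coe_nat]
  push_cast
  rw [hpq]
  rcases h.ramified_or_split_or_inert hR with ⟨-, h1, h2⟩ | ⟨-, h1, h2⟩ | ⟨h0, h1, h2⟩
  · rw [h1, h2] at hsum
    have h3 := hev R
    rw [Finsupp.single_apply, if_congr (h.eq_iff_of_conj_eq hP hR h1) rfl rfl] at h3
    obtain ⟨m, hm⟩ := h3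
    exact ⟨m + multiplicity q n.denom, by omega⟩
  · rw [h2, one_mul] at hsum
    rw [← h.single_add_single_conj hP hR h1]
    obtain ⟨m, hm⟩ := hev R
    obtain ⟨m', hm'⟩ := hev (R.conj σ)
    exact ⟨m + m' + multiplicity q n.denom, by omega⟩
  · rw [h1, h2, one_mul] at hsum
    have hne : p ≠ q := by
      intro he
      rw [← h.eq_iff_of_conj_eq hP hR h1] at he
      rw [he] at hdeg
      omega
    rw [if_neg hne]
    exact ⟨R.ord w + multiplicity q n.denom, by omega⟩

lemma exists_norm_eq_of_even [FiniteDimensional (RatFunc k) K] (h : IsDoubleCover f y σ)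
    (hP : P.LiesOver p) (hdeg : P.inertiaDegree (RatFunc k) = 1) (hpdeg : Even p.natDegree)
    {w : K} (hw : w ≠ 0)
    (hev : ∀ R : Point k K, Even (R.ord w + Finsupp.single P (1 : ℤ) R)) :
    ∃ a : K, algebraMap k[X] (RatFunc k) p = Algebra.norm (RatFunc k) a := by
  have hn0 := h.norm_ne_zero hw
  have hnum := RatFunc.num_ne_zero hn0
  obtain ⟨c, r, hc, hr, hcr⟩ := exists_eq_C_mul_sq _
    (mul_ne_zero (mul_ne_zero hP.irreducible.ne_zero hnum)
      (Algebra.norm (RatFunc k) w).denom_ne_zero)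
    (fun q hq hqi => h.even_multiplicity hP hdeg hw hev hq hqi)
  obtain ⟨a, b, hab⟩ := h.exists_eq w
  have hnorm : Algebra.norm (RatFunc k) w =
      a ^ 2 - algebraMap k[X] (RatFunc k) f * b ^ 2 := by rw [hab, h.norm_eq]
  set n := Algebra.norm (RatFunc k) w
  have hinj := IsFractionRing.injective k[X] (RatFunc k)
  have hne : ∀ g : k[X], g ≠ 0 → algebraMap k[X] (RatFunc k) g ≠ 0 := fun g hg =>
    (map_ne_zero_iff _ hinj).2 hg
  have hnd := hne _ n.denom_ne_zero
  have hden : ∀ z : RatFunc k, algebraMap k[X] (RatFunc k) z.num =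
      z * algebraMap k[X] (RatFunc k) z.denom := fun z =>
    (div_eq_iff (hne _ z.denom_ne_zero)).1 (RatFunc.num_div_denom z)
  have hpn : algebraMap k[X] (RatFunc k) p * n * algebraMap k[X] (RatFunc k) n.denom ^ 2 =
      algebraMap k[X] (RatFunc k) (C c) * algebraMap k[X] (RatFunc k) r ^ 2 := by
    rw [← map_pow _ r, ← map_mul, ← hcr, map_mul, map_mul, hden n]
    ring
  -- Clearing the denominators of `a` and `b` in `N(w) = a² - f b²` gives the polynomial identity
  -- needed to compare leading coefficients.
  have hclear : p * ((a.num * b.denom) ^ 2 - f * (b.num * a.denom) ^ 2) * n.denom ^ 2 =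
      C c * (r * (a.denom * b.denom)) ^ 2 := by
    apply hinj
    have e1 : algebraMap k[X] (RatFunc k) ((a.num * b.denom) ^ 2 - f * (b.num * a.denom) ^ 2) =
        n * algebraMap k[X] (RatFunc k) (a.denom * b.denom) ^ 2 := by
      rw [hnorm]
      simp only [map_sub, map_mul, map_pow, hden a, hden b]
      ring
    simp only [map_mul _ (p * _), map_mul _ p, e1, map_mul _ (C c), map_mul _ r, map_pow]
    linear_combination algebraMap k[X] (RatFunc k) (a.denom * b.denom) ^ 2 * hpn
  obtain ⟨s, hs⟩ := isSquare_of_mul_eq_C_mul_sq h.odd_natDegree hP.monic hpdeg hc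
    (mul_ne_zero hr (mul_ne_zero a.denom_ne_zero b.denom_ne_zero)) hclear
  -- With `c = s²`, `hpn` reads `p · N(w) = (s r / n.denom)²`, and the square of a rational function
  -- is its norm.
  refine ⟨algebraMap (RatFunc k) K (algebraMap k[X] (RatFunc k) (C s * r) /
    algebraMap k[X] (RatFunc k) n.denom) * w⁻¹, ?_⟩
  have hz : ∀ z : RatFunc k, Algebra.norm (RatFunc k) (algebraMap (RatFunc k) K z) = z ^ 2 :=
    fun z => by simpa using h.norm_eq z 0
  have hinv : Algebra.norm (RatFunc k) w⁻¹ = n⁻¹ :=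
    eq_inv_of_mul_eq_one_left (by rw [← map_mul, inv_mul_cancel₀ hw, map_one])
  rw [map_mul, hz, hinv]
  rw [hs, map_mul, map_mul] at hpn
  rw [map_mul]
  field_simp
  linear_combination hpn

/-! ### From a norm to divisibility of the class -/

lemma exists_even_of_norm_eq [Algebra.IsAlgebraic (RatFunc k) K] (h : IsDoubleCover f y σ)
    (hP : P.LiesOver p) (hdeg : P.inertiaDegree (RatFunc k) = 1) (hpdeg : Even p.natDegree)
    {a : K} (ha : algebraMap k[X] (RatFunc k) p = Algebra.norm (RatFunc k) a) :
    ∃ w : K, w ≠ 0 ∧ ∀ R : Point k K, Even (R.ord w + Finsupp.single P (1 : ℤ) R) := by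
  classical
  have ha0 : a ≠ 0 := by
    rintro rfl
    have h1 : algebraMap (RatFunc k) K (algebraMap k[X] (RatFunc k) p) = 0 := by
      rw [ha, h.algebraMap_norm, zero_mul]
    exact polyMap_ne_zero hP.irreducible.ne_zero h1
  have hsum : ∀ R : Point k K, R.ord a + (R.conj σ).ord a = R.ord (polyMap K p) := fun R => by
    rw [h.ord_add_ord_conj R ha0, ← ha, polyMap_apply]
  let S : Set (Point k K) := {R | R.ord a ≠ 0} ∪ {P}
  have hS : S.Finite := (h.finite_setOf_ord_ne_zero ha0).union (Set.finite_singleton P)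
  -- The polynomials below the split fibres on which `div a - P` is odd. Such a `q` has valuation
  -- one at both points of its fibre, so multiplying `a` by the product `g` of these polynomials
  -- changes both parities.
  let T : Set k[X] := {q | ∃ R : Point k K, R.LiesOver q ∧ R.conj σ ≠ R ∧
    Odd (R.ord a + Finsupp.single P (1 : ℤ) R)}
  have hT : T.Finite := by
    refine (Set.Finite.biUnion (t := fun R : Point k K => {q | R.LiesOver q}) hS fun R _ =>
      Set.Subsingleton.finite fun q hq q' hq' => LiesOver.eq hq' hq).subset ?_
    rintro q ⟨R, hR, -, hodd⟩
    refine Set.mem_biUnion (x := R) ?_ hR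
    by_contra hcon
    have hcon1 : R.ord a = 0 := by
      by_contra h1
      exact hcon (Or.inl h1)
    have hcon2 : R ≠ P := fun h1 => hcon (Or.inr h1)
    rw [hcon1, Finsupp.single_eq_of_ne hcon2] at hodd
    simp at hodd
  have hTmi : ∀ q ∈ hT.toFinset, q.Monic ∧ Irreducible q := fun q hq => by
    obtain ⟨R, hR, -⟩ := hT.mem_toFinset.1 hq
    exact ⟨hR.monic, hR.irreducible⟩
  let g : k[X] := ∏ q ∈ hT.toFinset, q
  have hg0 : g ≠ 0 := Finset.prod_ne_zero_iff.2 fun q hq => (hTmi q hq).2.ne_zero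
  have hgord : ∀ (R : Point k K) (q : k[X]), R.LiesOver q →
      R.ord (polyMap K g) = if q ∈ T then R.ord (polyMap K q) else 0 := by
    intro R q hR
    rw [map_prod, R.ord_prod _ _ fun i hi => polyMap_ne_zero (hTmi i hi).2.ne_zero,
      Finset.sum_congr rfl fun i hi => ord_polyMap_irreducible hR (hTmi i hi).1 (hTmi i hi).2,
      Finset.sum_ite_eq']
    simp only [Set.Finite.mem_toFinset]
  refine ⟨a * polyMap K g, mul_ne_zero ha0 (polyMap_ne_zero hg0), fun R => ?_⟩
  rw [R.ord_mul ha0 (polyMap_ne_zero hg0)]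
  by_cases hX : polyMap K (X : k[X]) ∈ R.ring
  · obtain ⟨q, hR⟩ := Point.exists_liesOver hX
    have hp := ord_polyMap_irreducible hR hP.monic hP.irreducible
    have hgR := hgord R q hR
    have hR' := hsum R
    rcases h.ramified_or_split_or_inert hR with ⟨-, h1, h2⟩ | ⟨-, h1, h2⟩ | ⟨h0, h1, h2⟩
    · have h3 : Finsupp.single P (1 : ℤ) R = if p = q then 1 else 0 := by
        rw [Finsupp.single_apply, if_congr (h.eq_iff_of_conj_eq hP hR h1) rfl rfl]
      rw [h1] at hR'
      rw [h3]
      grind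
    · have h3 := h.single_add_single_conj hP hR h1
      rw [h2] at hgR hp
      have hiff : q ∈ T ↔ Odd (R.ord a + Finsupp.single P (1 : ℤ) R) := by
        -- The sum of `div a + P` over the two points is twice the indicator of `p = q`, so oddness
        -- at one point is oddness at the other.
        refine ⟨?_, fun ho => ⟨R, hR, h1, ho⟩⟩
        rintro ⟨R', hRq', -, ho⟩
        rcases h.eq_or_eq_conj hR hRq' with h4 | h4
        · rwa [h4] at ho
        · rw [h4] at ho
          grind
      rw [hgR, if_congr hiff rfl rfl]
      grind
    · have hT' : q ∉ T := by
        rintro ⟨R', hRq', hne, -⟩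
        rcases h.eq_or_eq_conj hR hRq' with h4 | h4
        · rw [h4] at hne
          exact hne h1
        · rw [h4, h1] at hne
          exact hne h1
      have hpq : p ≠ q := by
        intro he
        rw [← h.eq_iff_of_conj_eq hP hR h1] at he
        rw [he] at hdeg
        omega
      have hPR : P ≠ R := mt (h.eq_iff_of_conj_eq hP hR h1).1 hpq
      rw [h1] at hR'
      rw [hgR, if_neg hT', Finsupp.single_eq_of_ne hPR.symm]
      rw [if_neg hpq] at hp
      exact ⟨0, by omega⟩
  · rw [Finsupp.single_eq_of_ne (ne_of_X_notMem hP hX).symm, add_zero]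
    refine Even.add ?_ (h.even_ord_polyMap_of_X_notMem hX g)
    have h1 := hsum R
    rw [h.conj_eq_of_ord_ne (h.ord_ne_of_X_notMem hX),
      ord_polyMap_of_X_notMem hX hP.irreducible.ne_zero] at h1
    obtain ⟨m, hm⟩ := hpdeg
    -- At infinity `2 ord a = deg p · ord x`; the evenness of `deg p` makes `ord a` a multiple of
    -- the even number `ord x`.
    have h2 : R.ord a = m * R.ord (polyMap K (X : k[X])) := by
      rw [hm] at h1
      push_cast at h1
      linarith
    rw [h2]
    exact (h.even_ord_X_of_X_notMem hX).mul_left _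

end IsDoubleCover

end FunctionFieldCurve

theorem mainTheorem4 {k : Type*} [Field k] [Finite k] (hchar : ringChar k ≠ 2)
    (f : k[X]) (hdeg : Odd f.natDegree) (hsmooth : FunctionFieldCurve.IsSmoothAffineCurve f)
    (K : Type*) [Field K] [Algebra k K] [Algebra (RatFunc k) K]
    [IsScalarTower k (RatFunc k) K] [FiniteDimensional (RatFunc k) K]
    (hK : FunctionFieldCurve.IsFunctionFieldOf f K)
    (P : FunctionFieldCurve.Point k K) (hP : Even P.degree) :
    (∃ c : FunctionFieldCurve.Pic k K, P.picClass = 2 • c) ↔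
      ∃ a : K, FunctionFieldCurve.divisorNormFunction (Finsupp.single P 1) =
        Algebra.norm (RatFunc k) a := by
  obtain ⟨y, σ, h⟩ := hK.exists_isDoubleCover (Ring.two_ne_zero hchar) hdeg hsmooth
  obtain ⟨p, hPp⟩ := FunctionFieldCurve.Point.exists_liesOver (h.X_mem_of_even_degree hP)
  rw [h.exists_picClass_eq_two_smul_iff,
    FunctionFieldCurve.IsDoubleCover.divisorNormFunction_single hPp]
  have hrational (hr : P.IsResiduallyRational) :
      (∃ w : K, w ≠ 0 ∧ ∀ R : FunctionFieldCurve.Point k K,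
        Even (R.ord w + Finsupp.single P (1 : ℤ) R)) ↔
      ∃ a : K, algebraMap k[X] (RatFunc k) p ^ P.inertiaDegree (RatFunc k) =
        Algebra.norm (RatFunc k) a := by
    have hi := hr.inertiaDegree_eq_one
    rw [hPp.degree_eq hr] at hP
    rw [hi, pow_one]
    exact ⟨fun ⟨w, hw, hev⟩ => h.exists_norm_eq_of_even hPp hi hP hw hev,
      fun ⟨a, ha⟩ => h.exists_even_of_norm_eq hPp hi hP ha⟩
  rcases h.ramified_or_split_or_inert hPp with ⟨hr, -⟩ | ⟨hr, -⟩ | ⟨hi, he, h1⟩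
  · exact hrational hr
  · exact hrational hr
  -- In the inert case `p` serves both sides: its divisor is congruent to `P` modulo two, and its
  -- norm is `p²`.
  · refine iff_of_true ⟨_, FunctionFieldCurve.polyMap_ne_zero hPp.irreducible.ne_zero,
      h.even_ord_polyMap_add_single_of_inert hPp he h1⟩
      ⟨algebraMap (RatFunc k) K (algebraMap k[X] (RatFunc k) p), ?_⟩
    rw [hi]
    simpa using (h.norm_eq (algebraMap k[X] (RatFunc k) p) 0).symm
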